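/- Let $\mathrm{O}$ be a finite set of modalities. Formulas are built from variables $p_0,p_1,\dots$ by Boolean connectives and unary $\lozenge\in \mathrm{O}$; $\Box=\neg\lozenge\neg$; a $k$-formula uses only $p_i$ with $i<k$. A logic is a normal modal logic $L$ over $\mathrm{O}$: a set of formulas containing all tautologies, $\neg\lozenge\bot$ and $\lozenge(p\vee q)\to\lozenge p\vee\lozenge q$ ($\lozenge\in\mathrm O$), closed under modus ponens, substitution and monotonicity ($\varphi\to\psi\in L$ implies $\lozenge\varphi\to\lozenge\psi\in L$). $L$ is locally tabular if for each $k<\omega$ there are only finitely many $k$-formulas up to the equivalence $\varphi\leftrightarrow\psi\in L$. Put $\lozenge^{\vee}\varphi=\bigvee_{\lozenge\in \mathrm{O}}\lozenge\varphi$. $L$ is $m$-transitive if $(\lozenge^{\vee})^m p\to\bigvee_{j<m}(\lozenge^{\vee})^j p\in L$, and pretransitive if it is $m$-transitive for some $m<\omega$; then $\lozenge^*\varphi=\bigvee_{j<m}(\lozenge^\vee)^j\varphi$ for the least such $m$. A pretransitive $L$ has finite height if for some $n<\omega$ it contains the formula obtained from $\mathrm{bh}_n$ by replacing $\lozenge$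 with $\lozenge^*$, where $\mathrm{bh}_0=\bot$ and $\mathrm{bh}_{n+1}=p_{n+1}\to\Box(\lozenge p_{n+1}\vee \mathrm{bh}_n)$. The $k$-canonical general frame $G$ of $L$ has as points the maximal $L$-consistent sets of $k$-formulas, relations $a R_\lozenge b\iff \{\lozenge\psi\mid\psi\in b\}\subseteq a$, and as its algebra the family of values of all $k$-formulas under the canonical valuation $p_i\mapsto\{a\mid p_i\in a\}$ (a subalgebra of the powerset with operations $\lozenge U=R_\lozenge^{-1}(U)$). Let $R^*$ be the reflexive transitive closure of $\bigcup_{\lozenge}R_\lozenge$; clusters of $G$ are the classes of the equivalence "$aR^*b$ and $bR^*a$". For a set $Y$ of points, $G{\upharpoonright}Y$ has domain $Y$, the restricted relations, and the family $\{U\cap Y\mid U\text{ in the algebra of }G\}$; $G\langle Y\rangle=G{\upharpoonright}R^*[Y]$, where $R^*[Y]=\{a\mid bR^*a\text{ for some }b\in Y\}$. The logic $\mathrm{Log}(H)$ of a general frame $H$ is the set of formulas valid in the algebra of $H$. An algebra is $k$-generated if it is generated by a set of at most $k$ elements. **Theorem.** Let $L$ be a pretransitive logic of finite height that is not locally tabular.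 Then there exist $k<\omega$ and a cluster $C$ in the $k$-canonical general frame $G$ of $L$ such that: (a) $C$ is infinite, and its complement in $G\langle C\rangle$ is finite. (b) There is a ($k$-)formula $\tau$ such that for every point $a$ of $G\langle C\rangle$, $a\in C$ iff $\tau\in a$; in particular, $C$ belongs to the algebra of $G\langle C\rangle$. (c) $G{\upharpoonright}C$ is a general frame (that is, its family of sets is closed under the Boolean operations and under the operations $\lozenge$ of its relations), and its algebra is infinite and $k$-generated. (d) $\mathrm{Log}(G{\upharpoonright}C)$ is not locally tabular. -/

import Mathlib

namespace Modal

/-- Modal formulas over an alphabet `O` of modalities, with variables `p_i` (`i : ℕ`).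
The Boolean primitives are falsum and implication. -/
inductive Form (O : Type*) : Type _
  | var (i : ℕ) : Form O
  | bot : Form O
  | imp (φ ψ : Form O) : Form O
  | dia (o : O) (φ : Form O) : Form O

namespace Form

variable {O : Type*}

def neg (φ : Form O) : Form O := imp φ bot
def top : Form O := neg bot
def or (φ ψ : Form O) : Form O := imp (neg φ) ψ
def and (φ ψ : Form O) : Form O := neg (imp φ (neg ψ))
def iff (φ ψ : Form O) : Form O := and (imp φ ψ) (imp ψ φ)
def box (o : O) (φ : Form O) : Form O := neg (dia o (neg φ))

/-- Finite disjunctions; the empty one is `⊥`. -/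
def bigOr (l : List (Form O)) : Form O := l.foldr or bot

/-- Finite conjunctions; the empty one is `⊤`. -/
def bigAnd (l : List (Form O)) : Form O := l.foldr and top

/-- Uniform substitution of formulas for variables. -/
def subst (σ : ℕ → Form O) : Form O → Form O
  | var i => σ i
  | bot => bot
  | imp φ ψ => imp (subst σ φ) (subst σ ψ)
  | dia o φ => dia o (subst σ φ)

/-- `φ` is a `k`-formula: all its variables are among `p_i`, `i < k`. -/
def IsK (k : ℕ) : Form O → Prop
  | var i => i < k
  | bot => True
  | imp φ ψ => IsK k φ ∧ IsK k ψ
  | dia _ φ => IsK k φ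

/-- Truth value of a formula when variables and formulas `◇φ` are treated as propositional atoms
with the truth values prescribed by `v`. -/
def propEval (v : Form O → Prop) : Form O → Prop
  | var i => v (var i)
  | bot => False
  | imp φ ψ => propEval v φ → propEval v ψ
  | dia o φ => v (dia o φ)

/-- Classical tautologies in the modal language. -/
def IsTautology (φ : Form O) : Prop := ∀ v : Form O → Prop, propEval v φ

/-- `⋁_{◇ ∈ O} ◇ φ`. -/
noncomputable def diaVee [Fintype O] (φ : Form O) : Form O :=
  bigOr ((Finset.univ : Finset O).toList.map fun o => dia o φ)

/-- `⋁_{j < k} (◇^∨)^j φ`. -/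
noncomputable def diaLt [Fintype O] (k : ℕ) (φ : Form O) : Form O :=
  bigOr ((List.range k).map fun j => diaVee^[j] φ)

/-- For a unimodal formula `φ`, replace each occurrence of its diamond by the operator `d` on
`O`-formulas. -/
def rep (d : Form O → Form O) : Form Unit → Form O
  | var i => var i
  | bot => bot
  | imp φ ψ => imp (rep d φ) (rep d ψ)
  | dia _ φ => d (rep d φ)

/-- The unimodal bounded height formulas:
`bh 0 = ⊥`, `bh (n+1) = p_{n+1} → □(◇ p_{n+1} ∨ bh n)`. -/
def bh : ℕ → Form Unit
  | 0 => bot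
  | n + 1 => imp (var (n + 1)) (box () (or (dia () (var (n + 1))) (bh n)))

end Form

open Form

section Logics

variable {O : Type*}

/-- Normal modal logics with alphabet `O`. -/
structure IsLogic (L : Set (Form O)) : Prop where
  taut : ∀ φ, IsTautology φ → φ ∈ L
  dia_bot : ∀ o, neg (dia o bot) ∈ L
  dia_or : ∀ o, imp (dia o (or (var 0) (var 1))) (or (dia o (var 0)) (dia o (var 1))) ∈ L
  mp : ∀ φ ψ, imp φ ψ ∈ L → φ ∈ L → ψ ∈ L
  subst : ∀ (σ : ℕ → Form O) φ, φ ∈ L → φ.subst σ ∈ L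
  mono : ∀ o φ ψ, imp φ ψ ∈ L → imp (dia o φ) (dia o ψ) ∈ L

/-- `L` is `k`-finite: there are finitely many classes of `L`-equivalent `k`-formulas. -/
def KFinite (L : Set (Form O)) (k : ℕ) : Prop :=
  {c : Set (Form O) | ∃ φ, IsK k φ ∧ c = {ψ | IsK k ψ ∧ iff φ ψ ∈ L}}.Finite

def LocallyTabular (L : Set (Form O)) : Prop := ∀ k, KFinite L k

/-- `L` contains `(◇^∨)^k p → ⋁_{j < k} (◇^∨)^j p`. -/
def KTransitive [Fintype O] (L : Set (Form O)) (k : ℕ) : Prop :=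
  imp (diaVee^[k] (var 0)) (diaLt k (var 0)) ∈ L

def Pretransitive [Fintype O] (L : Set (Form O)) : Prop := ∃ k, KTransitive L k

/-- The operator `◇*` of a pretransitive logic `L`: `◇* φ` is `⋁_{j < k} (◇^∨)^j φ` for the least
`k` such that `L` is `k`-transitive. -/
noncomputable def diaStar [Fintype O] (L : Set (Form O)) (φ : Form O) : Form O :=
  diaLt (sInf {k | KTransitive L k}) φ

/-- The height of a pretransitive logic; `⊤` stands for `ω`. -/
noncomputable def height [Fintype O] (L : Set (Form O)) : ℕ∞ :=
  sInf {m : ℕ∞ | ∃ n : ℕ, m = n ∧ rep (diaStar L) (bh n) ∈ L}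

end Logics

section Frames

variable {O : Type*} {X : Type*}

/-- A Kripke frame with domain `X` together with a family `adm` of subsets of `X`. It is a general
frame when `adm` is the carrier of a subalgebra of the algebra of the Kripke frame, see
`IsGeneralFrame`; the restriction of a general frame to an arbitrary set need not be one. -/
structure Frame (O : Type*) (X : Type*) where
  rel : O → X → X → Prop
  adm : Set (Set X)

/-- The modal operation `◇U = R_◇⁻¹(U)` of the algebra of the underlying Kripke frame. -/
def Frame.diaSet (G : Frame O X) (o : O) (U : Set X) : Set X := {a | ∃ b ∈ U, G.rel o a b}

structure Frame.IsGeneralFrame (G : Frame O X) : Prop where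
  empty_mem : ∅ ∈ G.adm
  compl_mem : ∀ U ∈ G.adm, Uᶜ ∈ G.adm
  union_mem : ∀ U ∈ G.adm, ∀ V ∈ G.adm, U ∪ V ∈ G.adm
  dia_mem : ∀ o, ∀ U ∈ G.adm, G.diaSet o U ∈ G.adm

/-- The carrier of the subalgebra of the algebra of the underlying Kripke frame generated by a
family `S` of sets. -/
inductive Frame.Generated (G : Frame O X) (S : Set (Set X)) : Set X → Prop
  | basic (U : Set X) : U ∈ S → Frame.Generated G S U
  | empty : Frame.Generated G S ∅
  | compl (U : Set X) : Frame.Generated G S U → Frame.Generated G S Uᶜ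
  | union (U V : Set X) :
      Frame.Generated G S U → Frame.Generated G S V → Frame.Generated G S (U ∪ V)
  | dia (o : O) (U : Set X) : Frame.Generated G S U → Frame.Generated G S (G.diaSet o U)

/-- The algebra of `G` is generated by a set of size at most `k`. -/
def Frame.AlgKGenerated (G : Frame O X) (k : ℕ) : Prop :=
  ∃ S : Set (Set X), S.encard ≤ k ∧ G.adm = {U | G.Generated S U}

/-- The value of a formula under a valuation `θ`. -/
def Frame.val (G : Frame O X) (θ : ℕ → Set X) : Form O → Set X
  | var i => θ i
  | bot => ∅
  | imp φ ψ => (G.val θ φ)ᶜ ∪ G.val θ ψ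
  | dia o φ => G.diaSet o (G.val θ φ)

/-- Validity in (the algebra of) `G`. -/
def Frame.Valid (G : Frame O X) (φ : Form O) : Prop :=
  ∀ θ : ℕ → Set X, (∀ i, θ i ∈ G.adm) → G.val θ φ = Set.univ

/-- The modal logic of `G`. -/
def Frame.Log (G : Frame O X) : Set (Form O) := {φ | G.Valid φ}

/-- The restriction of `G` to a set `Y` of points. -/
def Frame.restrict (G : Frame O X) (Y : Set X) : Frame O Y where
  rel o a b := G.rel o a b
  adm := {V | ∃ U ∈ G.adm, V = Subtype.val ⁻¹' U}

/-- The reflexive transitive closure of the union of the relations of `G`. -/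
def Frame.reach (G : Frame O X) : X → X → Prop :=
  Relation.ReflTransGen fun a b => ∃ o, G.rel o a b

/-- The domain `R*[Y]` of the subframe generated by `Y`. -/
def Frame.up (G : Frame O X) (Y : Set X) : Set X := {a | ∃ b ∈ Y, G.reach b a}

/-- The subframe generated by `Y`. -/
def Frame.gen (G : Frame O X) (Y : Set X) : Frame O (G.up Y) := G.restrict (G.up Y)

/-- `C` is a cluster: an equivalence class of mutual reachability. -/
def Frame.IsCluster (G : Frame O X) (C : Set X) : Prop :=
  ∃ a, C = {b | G.reach a b ∧ G.reach b a}

end Frames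

section Canonical

variable {O : Type*}

/-- `Γ` is `L`-consistent: no finite conjunction of members of `Γ` is refuted by `L`. -/
def Consistent (L Γ : Set (Form O)) : Prop :=
  ∀ l : List (Form O), (∀ φ ∈ l, φ ∈ Γ) → neg (bigAnd l) ∉ L

/-- The points of the `k`-canonical frame: maximal `L`-consistent sets of `k`-formulas. -/
def CanonPoint (L : Set (Form O)) (k : ℕ) : Type _ :=
  {a : Set (Form O) // Maximal (fun Γ => (∀ φ ∈ Γ, IsK k φ) ∧ Consistent L Γ) a}

/-- The canonical relations: `a R_◇ b` iff `◇ψ ∈ a` for all `ψ ∈ b`. -/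
def canonRel (L : Set (Form O)) (k : ℕ) (o : O) (a b : CanonPoint L k) : Prop :=
  ∀ ψ ∈ b.1, dia o ψ ∈ a.1

/-- The canonical valuation; only its values at `i < k` matter. -/
def canonVal (L : Set (Form O)) (k : ℕ) (i : ℕ) : Set (CanonPoint L k) := {a | var i ∈ a.1}

/-- The `k`-canonical general frame of `L`: its admissible sets are the values of `k`-formulas
under the canonical valuation. (`Frame.val` depends on the relations only.) -/
def canonFrame (L : Set (Form O)) (k : ℕ) : Frame O (CanonPoint L k) where
  rel := canonRel L k
  adm := {U | ∃ φ, IsK k φ ∧ U = Frame.val ⟨canonRel L k, ∅⟩ (canonVal L k) φ}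

end Canonical

end Modal

/-! If `L` fails to be `k`-finite, its `k`-canonical frame is infinite, because the class of a
formula is fixed by the set of points containing it. Let `heightSet L k n` consist of the points
containing every instance of the `n`-th height formula. It is empty for `n = 0` and, by finite
height, everything for some `n`; take the first infinite one, at `n + 1`. A point in it sees only
its own cluster and points of the finite set below (`reach_symm_or_mem_heightSet`).

Some point of this set has an infinite cone. Otherwise each of its points sees a finite set and is
isolated by a Jankov–Fine type formula (`exists_isolating`), and compactness makes the set finite
(`finite_heightSet`). The cluster of a point with infinite cone is therefore infinite and cofinite
in the subframe it generates. Cofiniteness makes it definable there (`exists_defining_cluster`), so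
its restriction is a general frame.

The variables need not generate the algebra of this restriction: `◇φ` may hold at a point of the
cluster because of a successor outside it. Only finitely many points lie outside, so finitely many
definable sets `{c | c R d}` suffice to repair this. They receive names as new variables:
substituting their definitions for these variables embeds the old canonical frame as a generated
subframe of one with more variables (`exists_cluster_with_names`). The image cluster has an infinite
algebra generated by its variables, which refutes local tabularity of its logic. -/

namespace Modal

variable {O : Type*}

/-! ### Syntax: propositional evaluation, variable bounds, substitution -/

namespace Form

instance : Nonempty (Form O) := ⟨bot⟩

@[simp] theorem propEval_neg (v : Form O → Prop) (φ : Form O) :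
    propEval v (neg φ) ↔ ¬ propEval v φ := Iff.rfl

@[simp] theorem propEval_bot (v : Form O → Prop) : propEval v bot ↔ False := Iff.rfl

@[simp] theorem propEval_imp (v : Form O → Prop) (φ ψ : Form O) :
    propEval v (imp φ ψ) ↔ (propEval v φ → propEval v ψ) := Iff.rfl

@[simp] theorem propEval_or (v : Form O → Prop) (φ ψ : Form O) :
    propEval v (Form.or φ ψ) ↔ propEval v φ ∨ propEval v ψ := by
  simp [Form.or, or_iff_not_imp_left]

@[simp] theorem propEval_and (v : Form O → Prop) (φ ψ : Form O) :
    propEval v (Form.and φ ψ) ↔ propEval v φ ∧ propEval v ψ := by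
  simp [Form.and]

@[simp] theorem propEval_iff (v : Form O → Prop) (φ ψ : Form O) :
    propEval v (Form.iff φ ψ) ↔ (propEval v φ ↔ propEval v ψ) := by
  simp [Form.iff, iff_def]

@[simp] theorem propEval_bigAnd (v : Form O → Prop) (l : List (Form O)) :
    propEval v (bigAnd l) ↔ ∀ ψ ∈ l, propEval v ψ := by
  induction l with
  | nil => simp [bigAnd, top]
  | cons φ l ih => simpa [bigAnd] using fun _ => ih

@[simp] theorem propEval_bigOr (v : Form O → Prop) (l : List (Form O)) :
    propEval v (bigOr l) ↔ ∃ ψ ∈ l, propEval v ψ := by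
  induction l with
  | nil => simp [bigOr]
  | cons φ l ih => simpa [bigOr] using or_congr Iff.rfl ih

@[simp] theorem isK_bot (k : ℕ) : IsK k (bot : Form O) := trivial

@[simp] theorem isK_imp {k : ℕ} {φ ψ : Form O} : IsK k (imp φ ψ) ↔ IsK k φ ∧ IsK k ψ := Iff.rfl

@[simp] theorem isK_dia {k : ℕ} {o : O} {φ : Form O} : IsK k (dia o φ) ↔ IsK k φ := Iff.rfl

@[simp] theorem isK_var {k i : ℕ} : IsK k (var i : Form O) ↔ i < k := Iff.rfl

@[simp] theorem isK_neg {k : ℕ} {φ : Form O} : IsK k (neg φ) ↔ IsK k φ := by simp [neg]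

@[simp] theorem isK_or {k : ℕ} {φ ψ : Form O} : IsK k (Form.or φ ψ) ↔ IsK k φ ∧ IsK k ψ := by
  simp [Form.or]

@[simp] theorem isK_and {k : ℕ} {φ ψ : Form O} : IsK k (Form.and φ ψ) ↔ IsK k φ ∧ IsK k ψ := by
  simp [Form.and]

@[simp] theorem isK_iff {k : ℕ} {φ ψ : Form O} : IsK k (Form.iff φ ψ) ↔ IsK k φ ∧ IsK k ψ := by
  simp [Form.iff]
  tauto

@[simp] theorem isK_bigAnd {k : ℕ} {l : List (Form O)} : IsK k (bigAnd l) ↔ ∀ ψ ∈ l, IsK k ψ := by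
  induction l with
  | nil => simp [bigAnd, top]
  | cons φ l ih => simpa [bigAnd] using fun _ => ih

@[simp] theorem isK_bigOr {k : ℕ} {l : List (Form O)} : IsK k (bigOr l) ↔ ∀ ψ ∈ l, IsK k ψ := by
  induction l with
  | nil => simp [bigOr]
  | cons φ l ih => simpa [bigOr] using fun _ => ih

theorem IsK.mono {k k' : ℕ} (h : k ≤ k') {φ : Form O} (hφ : IsK k φ) : IsK k' φ := by
  induction φ with
  | var i => exact lt_of_lt_of_le hφ h
  | bot => trivial
  | imp φ ψ ih1 ih2 => exact ⟨ih1 hφ.1, ih2 hφ.2⟩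
  | dia o φ ih => exact ih hφ

theorem IsK.subst {k k' : ℕ} {σ : ℕ → Form O} (hσ : ∀ i < k, IsK k' (σ i)) {φ : Form O}
    (hφ : IsK k φ) : IsK k' (φ.subst σ) := by
  induction φ with
  | var i => exact hσ i hφ
  | bot => trivial
  | imp φ ψ ih1 ih2 => exact ⟨ih1 hφ.1, ih2 hφ.2⟩
  | dia o φ ih => exact ih hφ

theorem IsK.subst_eq_self {k : ℕ} {σ : ℕ → Form O} (hσ : ∀ i < k, σ i = var i) {φ : Form O}
    (hφ : IsK k φ) : φ.subst σ = φ := by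
  induction φ with
  | var i => exact hσ i hφ
  | bot => rfl
  | imp φ ψ ih1 ih2 => simp only [Form.subst, ih1 hφ.1, ih2 hφ.2]
  | dia o φ ih => simp only [Form.subst, ih hφ]

@[simp] theorem subst_neg (σ : ℕ → Form O) (φ : Form O) :
    (neg φ).subst σ = neg (φ.subst σ) := rfl

theorem subst_bigAnd (σ : ℕ → Form O) (l : List (Form O)) :
    (bigAnd l).subst σ = bigAnd (l.map (Form.subst σ)) := by
  induction l with
  | nil => rfl
  | cons φ l ih =>
    change Form.and (φ.subst σ) ((bigAnd l).subst σ) = _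
    rw [ih]; rfl

theorem subst_bigOr (σ : ℕ → Form O) (l : List (Form O)) :
    (bigOr l).subst σ = bigOr (l.map (Form.subst σ)) := by
  induction l with
  | nil => rfl
  | cons φ l ih =>
    change Form.or (φ.subst σ) ((bigOr l).subst σ) = _
    rw [ih]; rfl

section Fintype

variable [Fintype O]

theorem subst_diaVee (σ : ℕ → Form O) (φ : Form O) :
    (diaVee φ).subst σ = diaVee (φ.subst σ) := by
  simp [diaVee, subst_bigOr, Function.comp_def, Form.subst]

theorem subst_diaVee_iterate (σ : ℕ → Form O) (j : ℕ) (φ : Form O) :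
    (diaVee^[j] φ).subst σ = diaVee^[j] (φ.subst σ) := by
  induction j generalizing φ with
  | zero => rfl
  | succ j ih => simp [ih, subst_diaVee]

theorem subst_diaLt (σ : ℕ → Form O) (m : ℕ) (φ : Form O) :
    (diaLt m φ).subst σ = diaLt m (φ.subst σ) := by
  rw [diaLt, subst_bigOr, List.map_map]
  exact congrArg bigOr (List.map_congr_left fun j _ => subst_diaVee_iterate σ j φ)

theorem IsK.diaVee {k : ℕ} {φ : Form O} (h : IsK k φ) : IsK k (diaVee φ) := by
  simp [Form.diaVee, h]

theorem IsK.diaVee_iterate {k : ℕ} {φ : Form O} (h : IsK k φ) (j : ℕ) :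
    IsK k (Form.diaVee^[j] φ) := by
  induction j with
  | zero => exact h
  | succ j ih => rw [Function.iterate_succ_apply']; exact ih.diaVee

theorem IsK.diaLt {k : ℕ} {φ : Form O} (h : IsK k φ) (m : ℕ) : IsK k (diaLt m φ) := by
  simp only [Form.diaLt, isK_bigOr, List.mem_map]
  rintro _ ⟨j, -, rfl⟩
  exact h.diaVee_iterate j

theorem IsK.diaStar {k : ℕ} {φ : Form O} (h : IsK k φ) (L : Set (Form O)) :
    IsK k (diaStar L φ) := h.diaLt _

end Fintype

end Form

open Form

/-! ### Maximal consistent sets and the canonical frame -/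

variable {L : Set (Form O)} {k : ℕ}

theorem IsLogic.mem_of_consequence (hL : IsLogic L) (l : List (Form O)) (hl : ∀ ψ ∈ l, ψ ∈ L)
    {φ : Form O} (h : ∀ v, (∀ ψ ∈ l, propEval v ψ) → propEval v φ) : φ ∈ L := by
  induction l generalizing φ with
  | nil => exact hL.taut _ fun v => h v (by simp)
  | cons ψ l ih =>
    refine hL.mp ψ φ (ih (fun χ hχ => hl χ (List.mem_cons_of_mem _ hχ)) ?_) (hl ψ (by simp))
    intro v hv hψ
    exact h v (by simpa using ⟨hψ, hv⟩)

theorem Consistent.lindenbaum {Γ : Set (Form O)} (hΓ : Consistent L Γ)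
    (hk : ∀ φ ∈ Γ, IsK k φ) : ∃ a : CanonPoint L k, Γ ⊆ a.1 := by
  obtain ⟨m, hm, hmax⟩ := zorn_subset_nonempty
    {Γ : Set (Form O) | (∀ φ ∈ Γ, IsK k φ) ∧ Consistent L Γ} (by
      intro c hc hchain hne
      refine ⟨⋃₀ c, ⟨?_, ?_⟩, fun s hs => Set.subset_sUnion_of_mem hs⟩
      · rintro φ ⟨s, hs, hφ⟩
        exact (hc hs).1 φ hφ
      · intro l hl
        have : ∃ s ∈ c, ∀ φ ∈ l, φ ∈ s := by
          induction l with
          | nil => exact ⟨hne.some, hne.some_mem, by simp⟩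
          | cons φ l ih =>
            obtain ⟨s, hs, hsl⟩ := ih fun ψ hψ => hl ψ (List.mem_cons_of_mem _ hψ)
            obtain ⟨t, ht, hφt⟩ := hl φ (by simp)
            obtain ⟨u, hu, hsu, htu⟩ := hchain.directedOn s hs t ht
            refine ⟨u, hu, ?_⟩
            simp only [List.mem_cons, forall_eq_or_imp]
            exact ⟨htu hφt, fun ψ hψ => hsu (hsl ψ hψ)⟩
        obtain ⟨s, hs, hsl⟩ := this
        exact (hc hs).2 l hsl) Γ ⟨hk, hΓ⟩
  exact ⟨⟨m, hmax⟩, hm⟩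

namespace CanonPoint

theorem isK (a : CanonPoint L k) {φ : Form O} (h : φ ∈ a.1) : IsK k φ := a.2.prop.1 φ h

/-- By maximality it suffices that adding `φ` keeps `a` consistent; in a refutation that uses `φ`,
the premises `l` can take its place. All closure properties of canonical points come from this. -/
theorem mem_of_consequence (hL : IsLogic L) (a : CanonPoint L k) (l : List (Form O))
    (hl : ∀ ψ ∈ l, ψ ∈ a.1 ∨ ψ ∈ L) {φ : Form O} (hφ : IsK k φ)
    (h : ∀ v, (∀ ψ ∈ l, propEval v ψ) → propEval v φ) : φ ∈ a.1 := by
  classical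
  refine a.2.le_of_ge (y := insert φ a.1) ⟨?_, ?_⟩ (Set.subset_insert _ _) (Set.mem_insert _ _)
  · rintro ψ (rfl | hψ)
    exacts [hφ, a.isK hψ]
  · intro l' hl' hcon
    refine a.2.prop.2 ((l' ++ l).filter (· ∈ a.1)) (fun ψ hψ => by
      simpa using (List.mem_filter.1 hψ).2) ?_
    refine hL.mem_of_consequence (neg (bigAnd l') :: l.filter (· ∈ L)) ?_ ?_
    · simpa using hcon
    · intro v hv
      simp only [List.mem_cons, forall_eq_or_imp, propEval_neg, propEval_bigAnd, List.mem_filter,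
        decide_eq_true_eq, List.mem_append, and_imp] at hv ⊢
      intro hv'
      refine hv.1 fun ψ hψ => ?_
      rcases hl' ψ hψ with rfl | hψa
      · refine h v fun χ hχ => ?_
        rcases hl χ hχ with h1 | h1
        exacts [hv' χ (Or.inr hχ) h1, hv.2 χ hχ h1]
      · exact hv' ψ (Or.inl hψ) hψa

theorem mem_of_mem_logic (hL : IsLogic L) (a : CanonPoint L k) {φ : Form O} (h : φ ∈ L)
    (hφ : IsK k φ) : φ ∈ a.1 :=
  a.mem_of_consequence hL [φ] (by simp [h]) hφ (by simp)

theorem bot_notMem (hL : IsLogic L) (a : CanonPoint L k) : bot ∉ a.1 := fun h =>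
  a.2.prop.2 [bot] (by simpa using h) (hL.taut _ fun v => by simp)

theorem mem_neg (hL : IsLogic L) (a : CanonPoint L k) {φ : Form O} (hφ : IsK k φ) :
    neg φ ∈ a.1 ↔ φ ∉ a.1 := by
  classical
  constructor
  · intro h1 h2
    exact a.bot_notMem hL (a.mem_of_consequence hL [φ, neg φ] (by simp [h1, h2]) (by simp)
      (by simp))
  · intro h
    have : ¬ Consistent L (insert φ a.1) := fun hc => h <|
      a.2.le_of_ge (y := insert φ a.1)
        ⟨by rintro ψ (rfl | hψ); exacts [hφ, a.isK hψ], hc⟩ (Set.subset_insert _ _)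
        (Set.mem_insert _ _)
    simp only [Consistent, not_forall, not_not] at this
    obtain ⟨l, hl, hcon⟩ := this
    refine a.mem_of_consequence hL (neg (bigAnd l) :: l.filter (· ∈ a.1)) ?_ (by simpa) ?_
    · simp only [List.mem_cons, List.mem_filter, decide_eq_true_eq, forall_eq_or_imp, and_imp]
      exact ⟨Or.inr hcon, fun ψ _ h => Or.inl h⟩
    · intro v hv hvφ
      simp only [List.mem_cons, forall_eq_or_imp, propEval_neg, propEval_bigAnd, List.mem_filter,
        decide_eq_true_eq, and_imp] at hv
      refine hv.1 fun ψ hψ => ?_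
      rcases hl ψ hψ with rfl | h1
      exacts [hvφ, hv.2 ψ hψ h1]

/-- Membership in a canonical point is itself a propositional valuation, so the rules for the
Boolean connectives below are read off from `propEval`. -/
theorem propEval_mem (hL : IsLogic L) (a : CanonPoint L k) {φ : Form O} (hφ : IsK k φ) :
    propEval (· ∈ a.1) φ ↔ φ ∈ a.1 := by
  induction φ with
  | var i => rfl
  | bot => simpa using a.bot_notMem hL
  | dia o φ => rfl
  | imp φ ψ ih1 ih2 =>
    rw [propEval_imp, ih1 hφ.1, ih2 hφ.2]
    constructor
    · intro h
      by_cases h1 : φ ∈ a.1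
      · exact a.mem_of_consequence hL [ψ] (by simp [h h1]) hφ (by simp +contextual)
      · exact a.mem_of_consequence hL [neg φ] (by simp [a.mem_neg hL hφ.1, h1]) hφ
          (by simp +contextual)
    · intro h h1
      exact a.mem_of_consequence hL [φ, imp φ ψ] (by simp [h, h1]) hφ.2 (by simp +contextual)

theorem mem_imp (hL : IsLogic L) (a : CanonPoint L k) {φ ψ : Form O} (hφ : IsK k φ)
    (hψ : IsK k ψ) : imp φ ψ ∈ a.1 ↔ (φ ∈ a.1 → ψ ∈ a.1) := by
  rw [← a.propEval_mem hL (by simp [*]), propEval_imp, a.propEval_mem hL hφ, a.propEval_mem hL hψ]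

theorem mem_or (hL : IsLogic L) (a : CanonPoint L k) {φ ψ : Form O} (hφ : IsK k φ)
    (hψ : IsK k ψ) : Form.or φ ψ ∈ a.1 ↔ φ ∈ a.1 ∨ ψ ∈ a.1 := by
  rw [← a.propEval_mem hL (by simp [*]), propEval_or, a.propEval_mem hL hφ, a.propEval_mem hL hψ]

theorem mem_and (hL : IsLogic L) (a : CanonPoint L k) {φ ψ : Form O} (hφ : IsK k φ)
    (hψ : IsK k ψ) : Form.and φ ψ ∈ a.1 ↔ φ ∈ a.1 ∧ ψ ∈ a.1 := by
  rw [← a.propEval_mem hL (by simp [*]), propEval_and, a.propEval_mem hL hφ,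
    a.propEval_mem hL hψ]

theorem mem_iff (hL : IsLogic L) (a : CanonPoint L k) {φ ψ : Form O} (hφ : IsK k φ)
    (hψ : IsK k ψ) : Form.iff φ ψ ∈ a.1 ↔ (φ ∈ a.1 ↔ ψ ∈ a.1) := by
  rw [← a.propEval_mem hL (by simp [*]), propEval_iff, a.propEval_mem hL hφ,
    a.propEval_mem hL hψ]

theorem mem_bigAnd (hL : IsLogic L) (a : CanonPoint L k) {l : List (Form O)}
    (hl : ∀ ψ ∈ l, IsK k ψ) : bigAnd l ∈ a.1 ↔ ∀ ψ ∈ l, ψ ∈ a.1 := by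
  rw [← a.propEval_mem hL (by simpa), propEval_bigAnd]
  exact forall₂_congr fun ψ hψ => a.propEval_mem hL (hl ψ hψ)

theorem mem_bigOr (hL : IsLogic L) (a : CanonPoint L k) {l : List (Form O)}
    (hl : ∀ ψ ∈ l, IsK k ψ) : bigOr l ∈ a.1 ↔ ∃ ψ ∈ l, ψ ∈ a.1 := by
  rw [← a.propEval_mem hL (by simpa), propEval_bigOr]
  exact exists_congr fun ψ => and_congr_right fun hψ => a.propEval_mem hL (hl ψ hψ)

theorem ext_of_subset (hL : IsLogic L) {a b : CanonPoint L k} (h : a.1 ⊆ b.1) : a = b := by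
  refine Subtype.ext (h.antisymm fun φ hφ => ?_)
  by_contra h1
  exact (b.mem_neg hL (b.isK hφ)).1 (h ((a.mem_neg hL (b.isK hφ)).2 h1)) hφ

theorem dia_mono (hL : IsLogic L) (a : CanonPoint L k) {o : O} {φ ψ : Form O}
    (h : imp φ ψ ∈ L) (hψ : IsK k ψ) (hφ : dia o φ ∈ a.1) : dia o ψ ∈ a.1 :=
  a.mem_of_consequence hL [dia o φ, imp (dia o φ) (dia o ψ)] (by simp [hφ, hL.mono o φ ψ h]) hψ
    (by simp +contextual)

theorem exists_dia_mem_of_dia_bigOr_mem (hL : IsLogic L) (a : CanonPoint L k) {o : O}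
    {l : List (Form O)} (h : dia o (bigOr l) ∈ a.1) : ∃ ψ ∈ l, dia o ψ ∈ a.1 := by
  induction l with
  | nil =>
    exact absurd h ((a.mem_neg hL (by simp [bigOr])).1
      (a.mem_of_mem_logic hL (hL.dia_bot o) (by simp)))
  | cons φ l ih =>
    have hk := a.isK h
    simp only [isK_dia, isK_bigOr, List.mem_cons, forall_eq_or_imp] at hk
    have hl : IsK k (dia o (bigOr l)) := by simpa using hk.2
    have h1 : imp (dia o (Form.or φ (bigOr l))) (Form.or (dia o φ) (dia o (bigOr l))) ∈ L :=
      hL.subst (fun i => if i = 0 then φ else bigOr l) _ (hL.dia_or o)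
    have h2 := a.mem_of_consequence hL [dia o (Form.or φ (bigOr l)), _] (φ :=
      Form.or (dia o φ) (dia o (bigOr l))) (by
        simp only [List.mem_cons, List.not_mem_nil, or_false, forall_eq_or_imp, forall_eq]
        exact ⟨Or.inl h, Or.inr h1⟩) (by simpa using hk) (by simp +contextual)
    rcases (a.mem_or hL (by simpa using hk.1) hl).1 h2 with h3 | h3
    · exact ⟨φ, by simp, h3⟩
    · obtain ⟨ψ, hψ, h4⟩ := ih h3
      exact ⟨ψ, List.mem_cons_of_mem _ hψ, h4⟩

/-- Existence lemma for canonical frames, for a set of formulas to be realized at once. -/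
theorem exists_rel_superset (hL : IsLogic L) (a : CanonPoint L k) (o : O) {Δ : Set (Form O)}
    (hΔ : ∀ ψ ∈ Δ, IsK k ψ)
    (h : ∀ l : List (Form O), (∀ ψ ∈ l, ψ ∈ Δ) → dia o (bigAnd l) ∈ a.1) :
    ∃ b : CanonPoint L k, canonRel L k o a b ∧ Δ ⊆ b.1 := by
  classical
  -- Any point extending `Δ` and all `χ` with `□χ ∈ a` is a successor of `a`. If these were
  -- inconsistent, a finite part of `Δ` would imply a disjunction of some `¬χ`; distributing `◇`
  -- over it puts some `◇¬χ` into `a`.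
  have hcon : Consistent L (Δ ∪ {χ | IsK k χ ∧ neg (dia o (neg χ)) ∈ a.1}) := by
    intro l hl hneg
    have h1 := h (l.filter (· ∈ Δ)) (by simp)
    have h2 : imp (bigAnd (l.filter (· ∈ Δ))) (bigOr ((l.filter (· ∉ Δ)).map neg)) ∈ L := by
      refine hL.mem_of_consequence [neg (bigAnd l)] (by simpa using hneg) fun v hv => ?_
      simp only [List.mem_cons, List.not_mem_nil, or_false, forall_eq, propEval_neg,
        propEval_bigAnd, not_forall] at hv
      obtain ⟨ψ, hψ, hv⟩ := hv
      rw [propEval_imp, propEval_bigAnd, propEval_bigOr]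
      intro hv'
      refine ⟨neg ψ, List.mem_map_of_mem ?_, hv⟩
      simp only [List.mem_filter, decide_eq_true_eq]
      exact ⟨hψ, fun h => hv (hv' ψ (by simp [hψ, h]))⟩
    have hk : ∀ ψ ∈ (l.filter (· ∉ Δ)), IsK k ψ ∧ neg (dia o (neg ψ)) ∈ a.1 := by
      intro ψ hψ
      simp only [List.mem_filter, decide_eq_true_eq] at hψ
      exact (hl ψ hψ.1).resolve_left hψ.2
    obtain ⟨χ, hχ, h3⟩ := a.exists_dia_mem_of_dia_bigOr_mem hL (a.dia_mono hL h2 (by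
      simp only [isK_bigOr, List.mem_map]
      rintro _ ⟨ψ, hψ, rfl⟩
      simpa using (hk ψ hψ).1) h1)
    obtain ⟨ψ, hψ, rfl⟩ := List.mem_map.1 hχ
    exact (a.mem_neg hL (a.isK h3)).1 (hk ψ hψ).2 h3
  obtain ⟨b, hb⟩ := hcon.lindenbaum (k := k) (by
    rintro φ (hφ | hφ)
    exacts [hΔ φ hφ, hφ.1])
  refine ⟨b, fun ψ hψ => ?_, Set.subset_union_left.trans hb⟩
  have hk := b.isK hψ
  by_contra hn
  refine (b.mem_neg hL hk).1 (hb (Or.inr ⟨by simpa, ?_⟩)) hψ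
  rw [a.mem_neg hL (by simpa)]
  exact fun h => hn (a.dia_mono hL (hL.taut _ fun v => by simp) hk h)

theorem mem_dia (hL : IsLogic L) (a : CanonPoint L k) {o : O} {φ : Form O} :
    dia o φ ∈ a.1 ↔ ∃ b : CanonPoint L k, canonRel L k o a b ∧ φ ∈ b.1 := by
  constructor
  · intro h
    have hk : IsK k φ := isK_dia.1 (a.isK h)
    obtain ⟨b, hb, hφ⟩ := a.exists_rel_superset hL o (Δ := {φ}) (by simpa) (fun l hl =>
      a.dia_mono hL (hL.taut _ fun v hv => by
        rw [propEval_bigAnd]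
        intro ψ hψ
        rwa [hl ψ hψ]) (by simpa using fun ψ hψ => by rwa [hl ψ hψ]) h)
    exact ⟨b, hb, hφ rfl⟩
  · rintro ⟨b, hb, hφ⟩
    exact hb φ hφ

end CanonPoint

/-- Truth lemma for canonical frames. -/
theorem val_canonVal (hL : IsLogic L) {φ : Form O} (hφ : IsK k φ) (F : Set (Set (CanonPoint L k))) :
    Frame.val ⟨canonRel L k, F⟩ (canonVal L k) φ = {a | φ ∈ a.1} := by
  induction φ with
  | var i => rfl
  | bot => ext a; simpa [Frame.val] using a.bot_notMem hL
  | imp φ ψ ih1 ih2 =>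
    ext a
    simp only [Frame.val, ih1 hφ.1, ih2 hφ.2, Set.mem_union, Set.mem_compl_iff, Set.mem_ofPred_eq,
      a.mem_imp hL hφ.1 hφ.2]
    tauto
  | dia o φ ih =>
    ext a
    simp only [Frame.val, ih hφ, Frame.diaSet, Set.mem_ofPred_eq, a.mem_dia hL]
    exact exists_congr fun b => and_comm

theorem mem_adm_canonFrame (hL : IsLogic L) {U : Set (CanonPoint L k)} :
    U ∈ (canonFrame L k).adm ↔ ∃ φ, IsK k φ ∧ U = {a | φ ∈ a.1} :=
  exists_congr fun φ => and_congr_right fun hφ => by rw [val_canonVal hL hφ]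

/-- Completeness with respect to the canonical frame. -/
theorem mem_of_forall_canonPoint (hL : IsLogic L) {φ : Form O} (hφ : IsK k φ)
    (h : ∀ a : CanonPoint L k, φ ∈ a.1) : φ ∈ L := by
  by_contra hn
  have hcon : Consistent L {neg φ} := by
    intro l hl hneg
    refine hn (hL.mem_of_consequence [neg (bigAnd l)] (by simpa using hneg) fun v hv => ?_)
    by_contra hvφ
    simp only [List.mem_cons, List.not_mem_nil, or_false, forall_eq, propEval_neg,
      propEval_bigAnd] at hv
    refine hv fun ψ hψ => ?_
    rw [Set.mem_singleton_iff.1 (hl ψ hψ)]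
    exact hvφ
  obtain ⟨a, ha⟩ := hcon.lindenbaum (k := k) (by simpa)
  exact (a.mem_neg hL hφ).1 (ha rfl) (h a)

/-- By completeness, `k`-formulas lying in the same points are equivalent, so there are at most as
many classes as sets of points. -/
theorem kFinite_of_finite_canonPoint (hL : IsLogic L) [Finite (CanonPoint L k)] :
    KFinite L k := by
  refine (Set.finite_range fun U : Set (CanonPoint L k) =>
    {ψ : Form O | IsK k ψ ∧ {a : CanonPoint L k | ψ ∈ a.1} = U}).subset ?_
  rintro c ⟨φ, hφ, rfl⟩
  refine ⟨{a | φ ∈ a.1}, Set.ext fun ψ => and_congr_right fun hψ => ⟨fun h => ?_, fun h => ?_⟩⟩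
  · refine mem_of_forall_canonPoint (k := k) hL (by simp [hφ, hψ]) fun a => ?_
    rw [a.mem_iff hL hφ hψ]
    exact (Set.ext_iff.1 h a).symm
  · ext a
    exact ((a.mem_iff hL hφ hψ).1 (a.mem_of_mem_logic hL h (by simp [hφ, hψ]))).symm

/-- Finite conjunctions at canonical points. -/
theorem exists_mem_iff_subset (hL : IsLogic L) {Θ : Set (Form O)} (hΘ : Θ.Finite)
    (hk : ∀ θ ∈ Θ, IsK k θ) :
    ∃ χ, IsK k χ ∧ ∀ a : CanonPoint L k, χ ∈ a.1 ↔ Θ ⊆ a.1 := by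
  have : ∀ ψ ∈ hΘ.toFinset.toList, IsK k ψ := by simpa using hk
  refine ⟨bigAnd hΘ.toFinset.toList, by simpa using hk, fun a => ?_⟩
  rw [a.mem_bigAnd hL this]
  simp [Set.subset_def]

/-- Finite disjunctions at canonical points. -/
theorem exists_mem_iff_inter_nonempty (hL : IsLogic L) {Θ : Set (Form O)} (hΘ : Θ.Finite)
    (hk : ∀ θ ∈ Θ, IsK k θ) :
    ∃ χ, IsK k χ ∧ ∀ a : CanonPoint L k, χ ∈ a.1 ↔ ∃ θ ∈ Θ, θ ∈ a.1 := by
  have : ∀ ψ ∈ hΘ.toFinset.toList, IsK k ψ := by simpa using hk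
  refine ⟨bigOr hΘ.toFinset.toList, by simpa using hk, fun a => ?_⟩
  rw [a.mem_bigOr hL this]
  simp

/-- A point is separated by a formula from any finite set of other points. -/
theorem exists_separating (hL : IsLogic L) (a : CanonPoint L k) {D : Set (CanonPoint L k)}
    (hD : D.Finite) : ∃ χ ∈ a.1, ∀ b ∈ D, χ ∈ b.1 → b = a := by
  have h : ∀ b : CanonPoint L k, ∃ χ ∈ a.1, χ ∈ b.1 → b = a := by
    intro b
    by_cases hb : b = a
    · exact ⟨neg bot, a.mem_of_mem_logic hL (hL.taut _ fun v => by simp) (by simp), fun _ => hb⟩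
    · obtain ⟨χ, h1, h2⟩ := Set.not_subset.1 fun h => hb (CanonPoint.ext_of_subset hL h).symm
      exact ⟨χ, h1, fun h => absurd h h2⟩
  choose f hf1 hf2 using h
  obtain ⟨χ, -, h2⟩ := exists_mem_iff_subset (k := k) hL (hD.image f) (by
    rintro _ ⟨b, -, rfl⟩
    exact a.isK (hf1 b))
  refine ⟨χ, (h2 a).2 ?_, fun b hb h => hf2 b ((h2 b).1 h ⟨b, hb, rfl⟩)⟩
  rintro _ ⟨b, -, rfl⟩
  exact hf1 b

/-- If each of the finitely many operators fails to carry some member of `b` into `a`, then they all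
fail on a common member of `b`. -/
theorem CanonPoint.exists_uniform (hL : IsLogic L) (a b : CanonPoint L k) {ι : Type*}
    {s : Set ι} (hs : s.Finite) (d : ι → Form O → Form O)
    (hd : ∀ i ∈ s, ∀ φ ψ, imp φ ψ ∈ L → imp (d i φ) (d i ψ) ∈ L)
    (hdk : ∀ i ∈ s, ∀ φ, IsK k φ → IsK k (d i φ))
    (h : ∀ ψ ∈ b.1, ∃ i ∈ s, d i ψ ∈ a.1) : ∃ i ∈ s, ∀ ψ ∈ b.1, d i ψ ∈ a.1 := by
  by_contra! hc
  choose! f hf1 hf2 using hc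
  have hk : ∀ θ ∈ (hs.image f).toFinset.toList, θ ∈ b.1 := by
    simpa using hf1
  obtain ⟨i, hi, h1⟩ := h (bigAnd (hs.image f).toFinset.toList)
    ((b.mem_bigAnd hL fun θ hθ => b.isK (hk θ hθ)).2 hk)
  refine hf2 i hi ?_
  have h2 : imp (bigAnd (hs.image f).toFinset.toList) (f i) ∈ L := hL.taut _ fun v hv => by
    rw [propEval_bigAnd] at hv
    exact hv _ (by simpa using ⟨i, hi, rfl⟩)
  have h3 := hdk i hi _ (b.isK (hf1 i hi))
  exact (a.mem_imp hL (a.isK h1) h3).1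
    (a.mem_of_mem_logic hL (hd i hi _ _ h2) ⟨a.isK h1, h3⟩) h1

/-! ### Reachability and the operator `◇*` -/

section Reach

variable [Fintype O]

theorem CanonPoint.mem_diaVee (hL : IsLogic L) (a : CanonPoint L k) {φ : Form O}
    (hφ : IsK k φ) : diaVee φ ∈ a.1 ↔ ∃ o, dia o φ ∈ a.1 := by
  rw [diaVee, a.mem_bigOr hL (by simpa using fun _ => hφ)]
  simp

theorem CanonPoint.mem_diaStar_iff_exists_iterate (hL : IsLogic L) (a : CanonPoint L k)
    {φ : Form O} (hφ : IsK k φ) :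
    diaStar L φ ∈ a.1 ↔ ∃ j < sInf {k | KTransitive L k}, diaVee^[j] φ ∈ a.1 := by
  rw [diaStar, diaLt, a.mem_bigOr hL]
  · simp
  · simp only [List.mem_map]
    rintro _ ⟨j, -, rfl⟩
    exact hφ.diaVee_iterate j

theorem Pretransitive.imp_diaStar_mem (hL : IsLogic L) (hpre : Pretransitive L) (φ : Form O) :
    imp (diaVee^[sInf {k | KTransitive L k}] φ) (diaStar L φ) ∈ L := by
  have h : KTransitive L (sInf {k | KTransitive L k}) := Nat.sInf_mem hpre
  have := hL.subst (fun _ => φ) _ h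
  simpa only [diaStar, Form.subst, subst_diaVee_iterate, subst_diaLt] using this

theorem CanonPoint.reach_of_mem_diaVee_iterate (hL : IsLogic L) {j : ℕ} (a : CanonPoint L k)
    {φ : Form O} (h : diaVee^[j] φ ∈ a.1) (hφ : IsK k φ) :
    ∃ b, (canonFrame L k).reach a b ∧ φ ∈ b.1 := by
  induction j generalizing a with
  | zero => exact ⟨a, .refl, h⟩
  | succ j ih =>
    rw [Function.iterate_succ_apply', a.mem_diaVee hL (hφ.diaVee_iterate j)] at h
    obtain ⟨o, ho⟩ := h
    obtain ⟨c, hac, hc⟩ := (a.mem_dia hL).1 ho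
    obtain ⟨b, hcb, hb⟩ := ih c hc
    exact ⟨b, .head ⟨o, hac⟩ hcb, hb⟩

/-- Along a path backwards from `b`, each step adds one to the exponent of `◇^∨`; when it reaches
`m`, pretransitivity brings it back below `m`. -/
theorem CanonPoint.mem_diaStar (hL : IsLogic L) (hpre : Pretransitive L) (a : CanonPoint L k)
    {φ : Form O} (hφ : IsK k φ) :
    diaStar L φ ∈ a.1 ↔ ∃ b, (canonFrame L k).reach a b ∧ φ ∈ b.1 := by
  set m := sInf {k | KTransitive L k} with hm
  have hstep : ∀ (c : CanonPoint L k) (j : ℕ), j ≤ m → diaVee^[j] φ ∈ c.1 →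
      diaStar L φ ∈ c.1 := by
    intro c j hj h
    rcases hj.lt_or_eq with hj | rfl
    · exact (c.mem_diaStar_iff_exists_iterate hL hφ).2 ⟨j, hj, h⟩
    · have hk1 := hφ.diaVee_iterate m
      exact (c.mem_imp hL hk1 (hφ.diaStar L)).1
        (c.mem_of_mem_logic hL (hpre.imp_diaStar_mem hL φ) ⟨hk1, hφ.diaStar L⟩) h
  constructor
  · rw [a.mem_diaStar_iff_exists_iterate hL hφ]
    rintro ⟨j, -, h⟩
    exact a.reach_of_mem_diaVee_iterate hL h hφ
  · rintro ⟨b, hab, hb⟩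
    induction hab using Relation.ReflTransGen.head_induction_on with
    | refl => exact hstep b 0 (Nat.zero_le _) hb
    | @head c d h _ ih =>
      obtain ⟨o, ho⟩ := h
      obtain ⟨j, hj, h⟩ := (d.mem_diaStar_iff_exists_iterate hL hφ).1 ih
      refine hstep c (j + 1) hj ?_
      rw [Function.iterate_succ_apply', c.mem_diaVee hL (hφ.diaVee_iterate j)]
      exact ⟨o, ho _ h⟩

theorem diaVee_iterate_mono (hL : IsLogic L) {φ ψ : Form O} (h : imp φ ψ ∈ L) (j : ℕ) :
    imp (diaVee^[j] φ) (diaVee^[j] ψ) ∈ L := by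
  induction j with
  | zero => exact h
  | succ j ih =>
    rw [Function.iterate_succ_apply', Function.iterate_succ_apply']
    refine hL.mem_of_consequence ((Finset.univ : Finset O).toList.map fun o =>
      imp (dia o (diaVee^[j] φ)) (dia o (diaVee^[j] ψ))) ?_ ?_
    · simpa using fun o => hL.mono o _ _ ih
    · intro v hv
      simp only [List.mem_map, Finset.mem_toList, Finset.mem_univ, true_and, forall_exists_index,
        forall_apply_eq_imp_iff, propEval_imp] at hv
      simp only [diaVee, propEval_imp, propEval_bigOr, List.mem_map, Finset.mem_toList,
        Finset.mem_univ, true_and, exists_exists_eq_and]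
      exact fun ⟨o, ho⟩ => ⟨o, hv o ho⟩

/-- The modality of the first step may depend on `ψ`, but there are finitely many, so one serves
every `ψ ∈ b`. Along it there is a successor realizing all `(◇^∨)^j ψ` at once, and induction
applies. -/
theorem CanonPoint.reach_of_forall_diaVee_iterate (hL : IsLogic L) {j : ℕ} (a b : CanonPoint L k)
    (h : ∀ ψ ∈ b.1, diaVee^[j] ψ ∈ a.1) : (canonFrame L k).reach a b := by
  induction j generalizing a with
  | zero => rw [ext_of_subset hL (a := b) (b := a) h]; exact .refl
  | succ j ih =>
    obtain ⟨o, -, ho⟩ := a.exists_uniform hL b (s := Set.univ) Set.finite_univ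
      (fun (o : O) φ => dia o (diaVee^[j] φ))
      (fun o _ φ ψ h => hL.mono o _ _ (diaVee_iterate_mono hL h j))
      (fun o _ φ hφ => hφ.diaVee_iterate j) (fun ψ hψ => by
        have := h ψ hψ
        rw [Function.iterate_succ_apply', a.mem_diaVee hL ((b.isK hψ).diaVee_iterate j)] at this
        simpa using this)
    obtain ⟨c, hac, hc⟩ := a.exists_rel_superset hL o (Δ := (fun ψ => diaVee^[j] ψ) '' b.1) (by
        rintro _ ⟨ψ, hψ, rfl⟩
        exact (b.isK hψ).diaVee_iterate j) (by
      -- A finite set of formulas `(◇^∨)^j ψ` follows from `(◇^∨)^j` of the conjunction of the `ψ`,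
      -- which again lies in `b`.
      intro l hl
      choose! f hf1 hf2 using hl
      have hf3 : ∀ ψ ∈ l.map f, ψ ∈ b.1 := by simpa using hf1
      refine a.dia_mono hL ?_ ?_ (ho (bigAnd (l.map f))
        ((b.mem_bigAnd hL fun θ hθ => b.isK (hf3 θ hθ)).2 hf3))
      · refine hL.mem_of_consequence (l.map fun ψ =>
          imp (diaVee^[j] (bigAnd (l.map f))) ψ) ?_ ?_
        · intro θ hθ
          obtain ⟨ψ, hψ, rfl⟩ := List.mem_map.1 hθ
          have := diaVee_iterate_mono hL (φ := bigAnd (l.map f)) (ψ := f ψ)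
            (hL.taut _ fun v hv => by
              rw [propEval_bigAnd] at hv
              exact hv _ (List.mem_map_of_mem hψ)) j
          simpa only [hf2 ψ hψ] using this
        · intro v hv hv'
          rw [propEval_bigAnd]
          intro ψ hψ
          exact hv _ (List.mem_map_of_mem hψ) hv'
      · rw [isK_bigAnd]
        intro ψ hψ
        rw [← hf2 ψ hψ]
        exact (b.isK (hf1 ψ hψ)).diaVee_iterate j)
    exact .head ⟨o, hac⟩ (ih c fun ψ hψ => hc ⟨ψ, hψ, rfl⟩)

/-- The transitive closure of the canonical relations is thus the canonical relation of `◇*`: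
failure of reachability is witnessed by a single formula. -/
theorem CanonPoint.reach_iff (hL : IsLogic L) (hpre : Pretransitive L) (a b : CanonPoint L k) :
    (canonFrame L k).reach a b ↔ ∀ ψ ∈ b.1, diaStar L ψ ∈ a.1 := by
  constructor
  · exact fun h ψ hψ => (a.mem_diaStar hL hpre (b.isK hψ)).2 ⟨b, h, hψ⟩
  · intro h
    obtain ⟨j, -, hj⟩ := a.exists_uniform hL b
      (s := Set.Iio (sInf {k | KTransitive L k})) (Set.finite_Iio _) (fun j φ => diaVee^[j] φ)
      (fun j _ φ ψ h => diaVee_iterate_mono hL h j) (fun j _ φ hφ => hφ.diaVee_iterate j)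
      (fun ψ hψ => (a.mem_diaStar_iff_exists_iterate hL (b.isK hψ)).1 (h ψ hψ))
    exact a.reach_of_forall_diaVee_iterate hL b hj

end Reach

/-! ### Finite height: isolated points and an infinite cluster -/

section FiniteHeight

variable [Fintype O]

/-- Instances of the bounded height formulas for the operator `◇*`. -/
noncomputable def starBh (L : Set (Form O)) (σ : ℕ → Form O) : ℕ → Form O
  | 0 => bot
  | n + 1 => imp (σ (n + 1))
      (neg (diaStar L (neg (Form.or (diaStar L (σ (n + 1))) (starBh L σ n)))))

theorem subst_rep_bh (L : Set (Form O)) (σ : ℕ → Form O) (n : ℕ) :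
    (rep (diaStar L) (bh n)).subst σ = starBh L σ n := by
  induction n with
  | zero => rfl
  | succ n ih =>
    rw [starBh, ← ih]
    change imp (σ (n + 1)) (neg ((diaStar L _).subst σ)) = _
    rw [diaStar, subst_diaLt]
    change imp (σ (n + 1)) (neg (diaStar L (neg (Form.or ((diaStar L _).subst σ) _)))) = _
    rw [diaStar, diaStar, subst_diaLt]
    rfl

theorem isK_starBh {σ : ℕ → Form O} (hσ : ∀ i, IsK k (σ i)) (n : ℕ) :
    IsK k (starBh L σ n) := by
  induction n with
  | zero => trivial
  | succ n ih =>
    rw [starBh, isK_imp, isK_neg]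
    refine ⟨hσ _, IsK.diaStar ?_ L⟩
    rw [isK_neg, isK_or]
    exact ⟨(hσ _).diaStar L, ih⟩

theorem starBh_congr {σ σ' : ℕ → Form O} {n : ℕ} (h : ∀ i ≤ n, σ i = σ' i) :
    starBh L σ n = starBh L σ' n := by
  induction n with
  | zero => rfl
  | succ n ih => rw [starBh, starBh, h _ le_rfl, ih fun i hi => h i (hi.trans n.le_succ)]

/-- Points of the canonical frame containing all instances of the `n`-th bounded height formula. -/
def heightSet (L : Set (Form O)) (k n : ℕ) : Set (CanonPoint L k) :=
  {a | ∀ σ : ℕ → Form O, (∀ i, IsK k (σ i)) → starBh L σ n ∈ a.1}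

theorem heightSet_zero (hL : IsLogic L) : heightSet L k 0 = ∅ :=
  Set.eq_empty_of_forall_notMem fun a ha =>
    a.bot_notMem hL (ha (fun _ => bot) fun _ => trivial)

theorem heightSet_eq_univ (hL : IsLogic L) {n : ℕ} (h : rep (diaStar L) (bh n) ∈ L) :
    heightSet L k n = Set.univ :=
  Set.eq_univ_of_forall fun a σ hσ => a.mem_of_mem_logic hL
    (by rw [← subst_rep_bh]; exact hL.subst σ _ h) (isK_starBh hσ n)

theorem reach_symm_or_mem_heightSet (hL : IsLogic L) (hpre : Pretransitive L) {n : ℕ}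
    {a b : CanonPoint L k} (ha : a ∈ heightSet L k (n + 1)) (hab : (canonFrame L k).reach a b) :
    (canonFrame L k).reach b a ∨ b ∈ heightSet L k n := by
  refine or_iff_not_imp_left.2 fun hba σ hσ => ?_
  rw [CanonPoint.reach_iff hL hpre] at hba
  push Not at hba
  obtain ⟨ψ, hψ, hψb⟩ := hba
  have hψk := a.isK hψ
  -- Here `ψ ∈ a` but `◇*ψ ∉ b`. Using `ψ` for the top variable, which does not occur in the `n`-th
  -- formula, forces the given instance of that formula at `b`.
  have hσ' : ∀ i, IsK k (Function.update σ (n + 1) ψ i) := by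
    intro i
    rcases eq_or_ne i (n + 1) with rfl | hi
    · simpa
    · simpa [hi] using hσ i
  have h1 := ha _ hσ'
  have h2 : starBh L (Function.update σ (n + 1) ψ) n = starBh L σ n :=
    starBh_congr fun i hi => Function.update_of_ne (by omega) _ _
  rw [starBh, h2, Function.update_self] at h1
  have hk1 := hψk.diaStar L
  have hk2 := isK_starBh (L := L) hσ n
  have hk3 : IsK k (neg (Form.or (diaStar L ψ) (starBh L σ n))) := by simp [hk1, hk2]
  have hk4 := hk3.diaStar L
  have h3 := (a.mem_neg hL hk4).1 ((a.mem_imp hL hψk (isK_neg.2 hk4)).1 h1 hψ)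
  rw [a.mem_diaStar hL hpre hk3] at h3
  by_contra hn
  refine h3 ⟨b, hab, ?_⟩
  rw [b.mem_neg hL (isK_neg.1 hk3), b.mem_or hL hk1 hk2]
  tauto

/-- In the canonical frame of a pretransitive logic, a point that sees finitely many points
is isolated. -/
theorem exists_isolating (hL : IsLogic L) (hpre : Pretransitive L) (a : CanonPoint L k)
    (hfin : {c | (canonFrame L k).reach a c}.Finite) :
    ∃ χ ∈ a.1, ∀ b : CanonPoint L k, χ ∈ b.1 → b = a := by
  set K := {c | (canonFrame L k).reach a c} with hK
  have haK : a ∈ K := .refl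
  choose α hα1 hα2 using fun c : CanonPoint L k => exists_separating hL c hfin
  have hαk : ∀ c, IsK k (α c) := fun c => c.isK (hα1 c)
  -- The finite diagram of the cone `K`: `α c` names `c` within `K`, and `A` records variables and
  -- which named points are seen. Below, `θ` says that some name holds and that each name forces its
  -- diagram.
  set A : Set (Form O) := var '' Set.Iio k ∪ (fun p : O × CanonPoint L k => dia p.1 (α p.2)) ''
    (Set.univ ×ˢ K) with hA
  have hAfin : A.Finite := ((Set.finite_Iio k).image _).union
    ((Set.finite_univ.prod hfin).image _)
  have hAk : ∀ ψ ∈ A, IsK k ψ := by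
    rintro _ (⟨i, hi, rfl⟩ | ⟨p, -, rfl⟩)
    exacts [hi, hαk p.2]
  obtain ⟨δ, hδk, hδ⟩ := exists_mem_iff_inter_nonempty (k := k) hL (hfin.image α) (by
    rintro _ ⟨c, -, rfl⟩
    exact hαk c)
  set Θ : Set (Form O) := {δ} ∪
    ((fun p : CanonPoint L k × Form O => imp (α p.1) p.2) '' {p ∈ K ×ˢ A | p.2 ∈ p.1.1} ∪
     (fun p : CanonPoint L k × Form O => imp (α p.1) (neg p.2)) '' {p ∈ K ×ˢ A | p.2 ∉ p.1.1})
    with hΘ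
  have hΘfin : Θ.Finite := (Set.finite_singleton _).union
    ((((hfin.prod hAfin).subset (Set.sep_subset _ _)).image _).union
     (((hfin.prod hAfin).subset (Set.sep_subset _ _)).image _))
  obtain ⟨θ, hθk, hθ⟩ := exists_mem_iff_subset (k := k) hL hΘfin (by
    rintro _ (rfl | ⟨p, hp, rfl⟩ | ⟨p, hp, rfl⟩)
    · exact hδk
    · simp [hαk, hAk _ hp.1.2]
    · simp [hαk, hAk _ hp.1.2])
  have hKθ : ∀ c ∈ K, θ ∈ c.1 := by
    intro c hc
    rw [hθ]
    rintro _ (rfl | ⟨⟨d, ψ⟩, ⟨⟨hd, hψ⟩, h⟩, rfl⟩ | ⟨⟨d, ψ⟩, ⟨⟨hd, hψ⟩, h⟩, rfl⟩)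
    · exact (hδ c).2 ⟨_, ⟨c, hc, rfl⟩, hα1 c⟩
    · rw [c.mem_imp hL (hαk d) (hAk _ hψ)]
      intro h'
      rw [hα2 d c hc h']
      exact h
    · rw [c.mem_imp hL (hαk d) (isK_neg.2 (hAk _ hψ)), c.mem_neg hL (hAk _ hψ)]
      intro h'
      rw [hα2 d c hc h']
      exact h
  have hnθk := (isK_neg.2 hθk)
  have hbox : ∀ b : CanonPoint L k, neg (diaStar L (neg θ)) ∈ b.1 ↔
      ∀ e, (canonFrame L k).reach b e → θ ∈ e.1 := by
    intro b
    rw [b.mem_neg hL (hnθk.diaStar L), b.mem_diaStar hL hpre hnθk]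
    push Not
    exact forall₂_congr fun e _ => by rw [e.mem_neg hL hθk, not_not]
  have hbk : IsK k (neg (diaStar L (neg θ))) := isK_neg.2 (hnθk.diaStar L)
  refine ⟨Form.and (α a) (neg (diaStar L (neg θ))),
    (a.mem_and hL (hαk a) hbk).2 ⟨hα1 a, (hbox a).2 hKθ⟩, fun b hb => ?_⟩
  rw [b.mem_and hL (hαk a) hbk, hbox b] at hb
  obtain ⟨hba, hb⟩ := hb
  have hdec : ∀ e, (canonFrame L k).reach b e → ∀ c ∈ K, α c ∈ e.1 → ∀ ψ ∈ A,
      (ψ ∈ e.1 ↔ ψ ∈ c.1) := by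
    intro e he c hc hce ψ hψ
    have h := (hθ e).1 (hb e he)
    by_cases h1 : ψ ∈ c.1
    · refine iff_of_true ((e.mem_imp hL (hαk c) (hAk _ hψ)).1 (h ?_) hce) h1
      exact Or.inr (Or.inl ⟨(c, ψ), ⟨⟨hc, hψ⟩, h1⟩, rfl⟩)
    · refine iff_of_false ((e.mem_neg hL (hAk _ hψ)).1
        ((e.mem_imp hL (hαk c) (isK_neg.2 (hAk _ hψ))).1 (h ?_) hce)) h1
      exact Or.inr (Or.inr ⟨(c, ψ), ⟨⟨hc, hψ⟩, h1⟩, rfl⟩)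
  -- Carrying the same name is a bisimulation between the cone of `b` and `K`, hence preserves all
  -- `k`-formulas.
  have key : ∀ φ, IsK k φ → ∀ e, (canonFrame L k).reach b e → ∀ c ∈ K, α c ∈ e.1 →
      (φ ∈ e.1 ↔ φ ∈ c.1) := by
    intro φ
    induction φ with
    | var i => exact fun hφ e he c hc h => hdec e he c hc h _ (Or.inl ⟨i, hφ, rfl⟩)
    | bot => exact fun _ e _ c _ _ => iff_of_false (e.bot_notMem hL) (c.bot_notMem hL)
    | imp φ ψ ih1 ih2 =>
      intro hφ e he c hc h
      rw [e.mem_imp hL hφ.1 hφ.2, c.mem_imp hL hφ.1 hφ.2, ih1 hφ.1 e he c hc h,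
        ih2 hφ.2 e he c hc h]
    | dia o φ ih =>
      intro hφ e he c hc h
      constructor
      · intro h1
        obtain ⟨e', hee', he'⟩ := (e.mem_dia hL).1 h1
        have hbe' : (canonFrame L k).reach b e' := he.tail ⟨o, hee'⟩
        obtain ⟨_, ⟨c', hc', rfl⟩, hce'⟩ :=
          (hδ e').1 ((hθ e').1 (hb e' hbe') (Or.inl rfl))
        have h2 := (ih hφ e' hbe' c' hc' hce').1 he'
        obtain ⟨c'', hcc'', hc''⟩ := (c.mem_dia hL).1 <|
          (hdec e he c hc h _ (Or.inr ⟨(o, c'), ⟨trivial, hc'⟩, rfl⟩)).1 (hee' _ hce')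
        rw [hα2 c' c'' (Relation.ReflTransGen.tail hc ⟨o, hcc''⟩) hc''] at hcc''
        exact hcc'' _ h2
      · intro h1
        obtain ⟨c', hcc', hc'⟩ := (c.mem_dia hL).1 h1
        have hc'K : c' ∈ K := Relation.ReflTransGen.tail hc ⟨o, hcc'⟩
        obtain ⟨e', hee', he'⟩ := (e.mem_dia hL).1 <|
          (hdec e he c hc h _ (Or.inr ⟨(o, c'), ⟨trivial, hc'K⟩, rfl⟩)).2 (hcc' _ (hα1 c'))
        exact hee' _ ((ih hφ e' (he.tail ⟨o, hee'⟩) c' hc'K he').2 hc')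
  exact CanonPoint.ext_of_subset hL fun φ hφ => (key φ (b.isK hφ) b .refl a haK hba).1 hφ

/-- A height set all of whose points see finitely many points is finite. -/
theorem finite_heightSet (hL : IsLogic L) (hpre : Pretransitive L) {n : ℕ}
    (h : ∀ a ∈ heightSet L k n, {c | (canonFrame L k).reach a c}.Finite) :
    (heightSet L k n).Finite := by
  choose! χ hχ1 hχ2 using fun a ha => exists_isolating hL hpre a (h a ha)
  set B : Set (Form O) := {φ | ∃ σ : ℕ → Form O, (∀ i, IsK k (σ i)) ∧ φ = starBh L σ n}
  have hχk : ∀ a ∈ heightSet L k n, IsK k (χ a) := fun a ha => a.isK (hχ1 a ha)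
  have hk : ∀ φ ∈ (fun a => neg (χ a)) '' heightSet L k n ∪ B, IsK k φ := by
    rintro _ (⟨a, ha, rfl⟩ | ⟨σ, hσ, rfl⟩)
    exacts [isK_neg.2 (hχk a ha), isK_starBh hσ n]
  -- A point containing this set would lie in the height set and violate its own isolating formula.
  -- So a finite part is already inconsistent, and finitely many `χ a` cover the height set.
  by_cases hcon : Consistent L ((fun a => neg (χ a)) '' heightSet L k n ∪ B)
  · obtain ⟨b, hb⟩ := hcon.lindenbaum hk
    have hbn : b ∈ heightSet L k n := fun σ hσ => hb (Or.inr ⟨σ, hσ, rfl⟩)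
    exact absurd (hχ1 b hbn) ((b.mem_neg hL (hχk b hbn)).1 (hb (Or.inl ⟨b, hbn, rfl⟩)))
  · simp only [Consistent, not_forall, not_not] at hcon
    obtain ⟨l, hl, hneg⟩ := hcon
    have hlk : ∀ φ ∈ l, IsK k φ := fun φ hφ => hk φ (hl φ hφ)
    have hf : (⋃ φ ∈ l, {a | a ∈ heightSet L k n ∧ φ = neg (χ a)}).Finite := by
      refine Set.Finite.biUnion (List.finite_toSet l) fun φ _ => ?_
      refine Set.Subsingleton.finite ?_
      rintro a ⟨ha, rfl⟩ b ⟨hb, hab⟩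
      have : χ a = χ b := by simpa [neg] using hab
      exact hχ2 b hb a (this ▸ hχ1 a ha)
    refine hf.subset fun a ha => ?_
    have h1 : neg (bigAnd l) ∈ a.1 := a.mem_of_mem_logic hL hneg (by simpa using hlk)
    rw [a.mem_neg hL (by simpa using hlk), a.mem_bigAnd hL hlk] at h1
    push Not at h1
    obtain ⟨φ, hφ, hφa⟩ := h1
    rcases hl φ hφ with ⟨b, hb, rfl⟩ | ⟨σ, hσ, rfl⟩
    · simp only [a.mem_neg hL (hχk b hb), not_not] at hφa
      obtain rfl := hχ2 b hb a hφa
      simp only [Set.mem_iUnion]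
      exact ⟨_, hφ, ha, rfl⟩
    · exact absurd (ha σ hσ) hφa

theorem exists_infinite_cluster (hL : IsLogic L) (hpre : Pretransitive L) (hfin : height L < ⊤)
    [Infinite (CanonPoint L k)] :
    ∃ C : Set (CanonPoint L k), (canonFrame L k).IsCluster C ∧ C.Infinite ∧
      ((canonFrame L k).up C \ C).Finite := by
  obtain ⟨_, ⟨N, -, hN⟩, -⟩ := sInf_lt_iff.1 hfin
  have hex : ∃ n, (heightSet L k n).Infinite :=
    ⟨N, by rw [heightSet_eq_univ hL hN]; exact Set.infinite_univ⟩
  classical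
  obtain ⟨n, hn⟩ : ∃ n, Nat.find hex = n + 1 := by
    refine Nat.exists_eq_succ_of_ne_zero fun h0 => ?_
    have := Nat.find_spec hex
    rw [h0, heightSet_zero hL] at this
    exact this Set.finite_empty
  have hinf : (heightSet L k (n + 1)).Infinite := hn ▸ Nat.find_spec hex
  have hfin' : (heightSet L k n).Finite :=
    Set.not_infinite.1 (Nat.find_min hex (by omega))
  obtain ⟨a, ha, hcone⟩ : ∃ a ∈ heightSet L k (n + 1),
      {c | (canonFrame L k).reach a c}.Infinite := by
    by_contra! h
    exact hinf (finite_heightSet hL hpre fun a ha => h a ha)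
  have hsub : ∀ b, (canonFrame L k).reach a b →
      b ∈ {b | (canonFrame L k).reach a b ∧ (canonFrame L k).reach b a} ∨
        b ∈ heightSet L k n := fun b hb =>
    (reach_symm_or_mem_heightSet hL hpre ha hb).imp_left fun h => ⟨hb, h⟩
  refine ⟨_, ⟨a, rfl⟩, fun h => hcone ((h.union hfin').subset hsub), hfin'.subset ?_⟩
  rintro b ⟨⟨c, hc, hcb⟩, hb⟩
  exact (hsub b (hc.1.trans hcb)).resolve_left hb

/-- A cluster is definable in the frame it generates if it has a finite complement there. -/
theorem exists_defining_cluster (hL : IsLogic L) (hpre : Pretransitive L)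
    {C : Set (CanonPoint L k)} (hC : (canonFrame L k).IsCluster C)
    (hfin : ((canonFrame L k).up C \ C).Finite) :
    ∃ τ : Form O, IsK k τ ∧ ∀ a ∈ (canonFrame L k).up C, a ∈ C ↔ τ ∈ a.1 := by
  obtain ⟨a, rfl⟩ := hC
  set C := {b | (canonFrame L k).reach a b ∧ (canonFrame L k).reach b a}
  -- A point `d` of the generated subframe outside `C` cannot see `a`, while all of `C` does; `τ` is
  -- the conjunction of the finitely many witnesses `◇*ψ`.
  have h : ∀ d : CanonPoint L k, ∃ ψ ∈ a.1,
      d ∈ (canonFrame L k).up C \ C → diaStar L ψ ∉ d.1 := by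
    intro d
    by_cases hd : d ∈ (canonFrame L k).up C \ C
    · obtain ⟨⟨c, hc, hcd⟩, hdC⟩ := hd
      have : ¬ (canonFrame L k).reach d a := fun h => hdC ⟨hc.1.trans hcd, h⟩
      rw [d.reach_iff hL hpre] at this
      push Not at this
      obtain ⟨ψ, hψ, h⟩ := this
      exact ⟨ψ, hψ, fun _ => h⟩
    · exact ⟨neg bot, a.mem_of_mem_logic hL (hL.taut _ fun v => by simp) (by simp),
        fun h => absurd h hd⟩
  choose f hf1 hf2 using h
  obtain ⟨τ, hτk, hτ⟩ := exists_mem_iff_subset (k := k) hL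
    (hfin.image fun d => diaStar L (f d)) (by
      rintro _ ⟨d, -, rfl⟩
      exact (a.isK (hf1 d)).diaStar L)
  refine ⟨τ, hτk, fun b hb => ?_⟩
  rw [hτ]
  constructor
  · rintro hbC _ ⟨d, -, rfl⟩
    exact (b.reach_iff hL hpre a).1 hbC.2 _ (hf1 d)
  · intro h
    by_contra hbC
    exact hf2 b ⟨hb, hbC⟩ (h ⟨b, ⟨hb, hbC⟩, rfl⟩)

end FiniteHeight

/-! ### General frames: generated algebras and local tabularity -/

section GeneralFrames

variable {X : Type*} {G : Frame O X} {θ : ℕ → Set X}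

theorem Frame.val_neg (φ : Form O) : G.val θ (neg φ) = (G.val θ φ)ᶜ := by
  simp [neg, Frame.val]

theorem Frame.val_iff_eq_univ {φ ψ : Form O} (h : G.val θ (Form.iff φ ψ) = Set.univ) :
    G.val θ φ = G.val θ ψ := by
  ext a
  have ha := Set.eq_univ_iff_forall.1 h a
  simp only [Form.iff, Form.and, neg, Frame.val, Set.mem_union, Set.mem_compl_iff,
    Set.mem_empty_iff_false] at ha
  tauto

theorem Frame.iff_self_mem_Log (φ : Form O) : Form.iff φ φ ∈ G.Log := by
  intro θ _
  refine Set.eq_univ_of_forall fun a => ?_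
  simp only [Form.iff, Form.and, neg, Frame.val, Set.mem_union, Set.mem_compl_iff,
    Set.mem_empty_iff_false]
  tauto

theorem Frame.IsGeneralFrame.val_mem (hG : G.IsGeneralFrame) {φ : Form O} (hφ : IsK k φ)
    (hθ : ∀ i < k, θ i ∈ G.adm) : G.val θ φ ∈ G.adm := by
  induction φ with
  | var i => exact hθ i hφ
  | bot => exact hG.empty_mem
  | imp φ ψ ih1 ih2 => exact hG.union_mem _ (hG.compl_mem _ (ih1 hφ.1)) _ (ih2 hφ.2)
  | dia o φ ih => exact hG.dia_mem o _ (ih hφ)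

theorem Frame.generated_iff_exists_val {U : Set X} :
    G.Generated (θ '' Set.Iio k) U ↔ ∃ φ, IsK k φ ∧ U = G.val θ φ := by
  constructor
  · intro h
    induction h with
    | basic U hU =>
      obtain ⟨i, hi, rfl⟩ := hU
      exact ⟨var i, hi, rfl⟩
    | empty => exact ⟨bot, trivial, rfl⟩
    | compl U _ ih =>
      obtain ⟨φ, hφ, rfl⟩ := ih
      exact ⟨neg φ, isK_neg.2 hφ, (Frame.val_neg φ).symm⟩
    | union U V _ _ ih1 ih2 =>
      obtain ⟨φ, hφ, rfl⟩ := ih1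
      obtain ⟨ψ, hψ, rfl⟩ := ih2
      refine ⟨Form.or φ ψ, isK_or.2 ⟨hφ, hψ⟩, ?_⟩
      rw [Form.or, Frame.val, Frame.val_neg, compl_compl]
    | dia o U _ ih =>
      obtain ⟨φ, hφ, rfl⟩ := ih
      exact ⟨dia o φ, hφ, rfl⟩
  · rintro ⟨φ, hφ, rfl⟩
    induction φ with
    | var i => exact .basic _ ⟨i, hφ, rfl⟩
    | bot => exact .empty
    | imp φ ψ ih1 ih2 => exact .union _ _ (.compl _ (ih1 hφ.1)) (ih2 hφ.2)
    | dia o φ ih => exact .dia o _ (ih hφ)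

/-- If infinitely many sets are values of `k`-formulas under one valuation, then the logic of the
frame is not locally tabular. -/
theorem Frame.not_locallyTabular_Log (hθ : ∀ i, θ i ∈ G.adm)
    (hinf : {U | ∃ φ, IsK k φ ∧ U = G.val θ φ}.Infinite) : ¬ LocallyTabular G.Log := by
  intro h
  refine hinf (((h k).image fun c => ⋃ ψ ∈ c, G.val θ ψ).subset ?_)
  rintro _ ⟨φ, hφ, rfl⟩
  refine ⟨_, ⟨φ, hφ, rfl⟩, Set.Subset.antisymm ?_ ?_⟩
  · refine Set.iUnion₂_subset fun ψ hψ => ?_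
    rw [Frame.val_iff_eq_univ (hψ.2 θ hθ)]
  · exact Set.subset_biUnion_of_mem (u := fun ψ => G.val θ ψ)
      (show φ ∈ {ψ | IsK k ψ ∧ Form.iff φ ψ ∈ G.Log} from ⟨hφ, Frame.iff_self_mem_Log φ⟩)

end GeneralFrames

variable {k' : ℕ}

/-! ### The algebra of the restriction to a definable cluster -/

section Restriction

variable {C : Set (CanonPoint L k)}

theorem mem_adm_restrict (hL : IsLogic L) {U : Set C} :
    U ∈ ((canonFrame L k).restrict C).adm ↔
      ∃ φ, IsK k φ ∧ U = {c : C | φ ∈ c.1.1} := by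
  constructor
  · rintro ⟨V, hV, rfl⟩
    obtain ⟨φ, hφ, rfl⟩ := (mem_adm_canonFrame hL).1 hV
    exact ⟨φ, hφ, rfl⟩
  · rintro ⟨φ, hφ, rfl⟩
    exact ⟨_, (mem_adm_canonFrame hL).2 ⟨φ, hφ, rfl⟩, rfl⟩

/-- Distinct points are separated by admissible sets, so finitely many such sets would leave
finitely many points. -/
theorem infinite_adm_restrict (hL : IsLogic L) (hC : C.Infinite) :
    ((canonFrame L k).restrict C).adm.Infinite := by
  intro hfin
  have := hC.to_subtype
  refine Set.infinite_range_of_injective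
    (f := fun c : C => {U | U ∈ ((canonFrame L k).restrict C).adm ∧ c ∈ U}) ?_
    (hfin.finite_subsets.subset ?_)
  · intro c d hcd
    refine Subtype.ext (CanonPoint.ext_of_subset hL fun φ hφ => ?_)
    exact ((Set.ext_iff.1 hcd {c : C | φ ∈ c.1.1}).1
      ⟨(mem_adm_restrict hL).2 ⟨φ, c.1.isK hφ, rfl⟩, hφ⟩).2
  · rintro _ ⟨c, rfl⟩
    exact fun U hU => hU.1

theorem isGeneralFrame_restrict (hL : IsLogic L) {τ : Form O} (hτ : IsK k τ)
    (hC : ∀ a ∈ (canonFrame L k).up C, a ∈ C ↔ τ ∈ a.1) :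
    ((canonFrame L k).restrict C).IsGeneralFrame where
  empty_mem := (mem_adm_restrict hL).2 ⟨bot, trivial, by
    ext c; simpa using c.1.bot_notMem hL⟩
  compl_mem U hU := by
    obtain ⟨φ, hφ, rfl⟩ := (mem_adm_restrict hL).1 hU
    refine (mem_adm_restrict hL).2 ⟨neg φ, isK_neg.2 hφ, ?_⟩
    ext c
    exact (c.1.mem_neg hL hφ).symm
  union_mem U hU V hV := by
    obtain ⟨φ, hφ, rfl⟩ := (mem_adm_restrict hL).1 hU
    obtain ⟨ψ, hψ, rfl⟩ := (mem_adm_restrict hL).1 hV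
    refine (mem_adm_restrict hL).2 ⟨Form.or φ ψ, isK_or.2 ⟨hφ, hψ⟩, ?_⟩
    ext c
    exact (c.1.mem_or hL hφ hψ).symm
  dia_mem o U hU := by
    obtain ⟨φ, hφ, rfl⟩ := (mem_adm_restrict hL).1 hU
    -- The conjunct `τ` discards successors outside `C`.
    refine (mem_adm_restrict hL).2 ⟨dia o (Form.and φ τ), isK_and.2 ⟨hφ, hτ⟩, ?_⟩
    ext c
    constructor
    · rintro ⟨b, hb, hcb⟩
      refine (c.1.mem_dia hL).2 ⟨b.1, hcb, (b.1.mem_and hL hφ hτ).2 ⟨hb, ?_⟩⟩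
      exact (hC b.1 ⟨b.1, b.2, .refl⟩).1 b.2
    · intro h
      obtain ⟨b, hcb, hb⟩ := (c.1.mem_dia hL).1 h
      rw [b.mem_and hL hφ hτ] at hb
      exact ⟨⟨b, (hC b ⟨c.1, c.2, .single ⟨o, hcb⟩⟩).2 hb.2⟩, hb.1, hcb⟩

/-- The admissible sets of the restriction to `C` are the values in `C` of `k`-formulas if the points
of `C` that see a given point outside are singled out by a variable. -/
theorem adm_restrict_eq (hL : IsLogic L) {τ : Form O} (hτ : IsK k τ)
    (hC : ∀ a ∈ (canonFrame L k).up C, a ∈ C ↔ τ ∈ a.1)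
    (hfin : ((canonFrame L k).up C \ C).Finite)
    (hvar : ∀ o, ∀ d ∈ (canonFrame L k).up C \ C,
      ∃ i < k, ∀ c ∈ C, canonRel L k o c d ↔ var i ∈ c.1) :
    ((canonFrame L k).restrict C).adm = {U | ∃ φ, IsK k φ ∧
      U = ((canonFrame L k).restrict C).val (fun i => {c : C | var i ∈ c.1.1}) φ} := by
  have hG := isGeneralFrame_restrict hL hτ hC
  ext U
  constructor
  · intro hU
    obtain ⟨φ, hφ, rfl⟩ := (mem_adm_restrict hL).1 hU
    clear hU
    refine Frame.generated_iff_exists_val.1 ?_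
    induction φ with
    | var i => exact .basic _ ⟨i, hφ, rfl⟩
    | bot =>
      convert Frame.Generated.empty
      ext c
      simpa using c.1.bot_notMem hL
    | imp φ ψ ih1 ih2 =>
      convert Frame.Generated.union _ _ (.compl _ (ih1 hφ.1)) (ih2 hφ.2)
      ext c
      simp only [Set.mem_union, Set.mem_compl_iff, Set.mem_ofPred_eq,
        c.1.mem_imp hL hφ.1 hφ.2]
      tauto
    | dia o φ ih =>
      -- Successors in `C` are handled by the operation `◇` of the restriction; those outside
      -- contribute a finite union of sets named by variables.
      have hgen : ∀ D : Set (CanonPoint L k), D.Finite → D ⊆ (canonFrame L k).up C \ C →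
          ((canonFrame L k).restrict C).Generated
            ((fun i => {c : C | var i ∈ c.1.1}) '' Set.Iio k)
            {c : C | ∃ d ∈ D, canonRel L k o c.1 d} := by
        intro D hD hDC
        induction D, hD using Set.Finite.induction_on with
        | empty =>
          convert Frame.Generated.empty
          simp
        | @insert d D _ _ ihD =>
          obtain ⟨i, hi, h⟩ := hvar o d (hDC (Set.mem_insert _ _))
          have hi' : ((canonFrame L k).restrict C).Generated
              ((fun i => {c : C | var i ∈ c.1.1}) '' Set.Iio k) {c : C | var i ∈ c.1.1} :=
            .basic _ ⟨i, hi, rfl⟩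
          convert Frame.Generated.union _ _ hi'
            (ihD ((Set.subset_insert _ _).trans hDC))
          ext c
          simp [h c.1 c.2]
      convert Frame.Generated.union _ _ (.dia o _ (ih hφ))
        (hgen {d ∈ (canonFrame L k).up C \ C | φ ∈ d.1} (hfin.subset (Set.sep_subset _ _))
          (Set.sep_subset _ _))
      ext c
      constructor
      · intro h
        obtain ⟨b, hcb, hb⟩ := (c.1.mem_dia hL).1 h
        by_cases hbC : b ∈ C
        · exact Or.inl ⟨⟨b, hbC⟩, hb, hcb⟩
        · exact Or.inr ⟨b, ⟨⟨⟨c.1, c.2, .single ⟨o, hcb⟩⟩, hbC⟩, hb⟩, hcb⟩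
      · rintro (⟨b, hb, hcb⟩ | ⟨b, hb, hcb⟩)
        · exact (c.1.mem_dia hL).2 ⟨b.1, hcb, hb⟩
        · exact (c.1.mem_dia hL).2 ⟨b, hcb, hb.2⟩
  · rintro ⟨φ, hφ, rfl⟩
    exact hG.val_mem hφ fun i hi => (mem_adm_restrict hL).2 ⟨var i, hi, rfl⟩

end Restriction

/-! ### Adding variables: generated embeddings of canonical frames -/

section Substitution

/-- The `k'`-canonical point of all `k'`-formulas whose substitution instance belongs to `a`. -/
def CanonPoint.comapSubst (hL : IsLogic L) (σ : ℕ → Form O) (hσ : ∀ i < k', IsK k (σ i))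
    (a : CanonPoint L k) : CanonPoint L k' where
  val := {φ | IsK k' φ ∧ φ.subst σ ∈ a.1}
  property := by
    refine ⟨⟨fun φ hφ => hφ.1, fun l hl hneg => ?_⟩, fun b hb hab φ hφ => ?_⟩
    · refine a.2.prop.2 (l.map (Form.subst σ)) ?_ ?_
      · simpa using fun φ hφ => (hl φ hφ).2
      · rw [← subst_bigAnd, ← subst_neg]
        exact hL.subst σ _ hneg
    · have hφk := hb.1 φ hφ
      refine ⟨hφk, ?_⟩
      by_contra hn
      have h1 : neg φ ∈ b :=
        hab ⟨isK_neg.2 hφk, (a.mem_neg hL (IsK.subst hσ hφk)).2 hn⟩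
      exact hb.2 [φ, neg φ] (by simp [hφ, h1]) (hL.taut _ fun v => by simp)

theorem CanonPoint.mem_comapSubst {hL : IsLogic L} {σ : ℕ → Form O}
    {hσ : ∀ i < k', IsK k (σ i)} (hkk' : k ≤ k') (hid : ∀ i < k, σ i = var i)
    {a : CanonPoint L k} {φ : Form O} (hφ : IsK k φ) :
    φ ∈ (a.comapSubst hL σ hσ).1 ↔ φ ∈ a.1 := by
  change IsK k' φ ∧ φ.subst σ ∈ a.1 ↔ _
  rw [hφ.subst_eq_self hid]
  exact and_iff_right (hφ.mono hkk')

theorem CanonPoint.comapSubst_injective {hL : IsLogic L} {σ : ℕ → Form O}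
    {hσ : ∀ i < k', IsK k (σ i)} (hkk' : k ≤ k') (hid : ∀ i < k, σ i = var i) :
    Function.Injective (CanonPoint.comapSubst hL σ hσ) := by
  intro a b hab
  refine CanonPoint.ext_of_subset hL fun φ hφ => ?_
  have hk := a.isK hφ
  rw [← CanonPoint.mem_comapSubst (hL := hL) (hσ := hσ) hkk' hid hk] at hφ ⊢
  rwa [← hab]

theorem canonRel_comapSubst {hL : IsLogic L} {σ : ℕ → Form O}
    {hσ : ∀ i < k', IsK k (σ i)} (hkk' : k ≤ k') (hid : ∀ i < k, σ i = var i)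
    {o : O} {a b : CanonPoint L k} :
    canonRel L k' o (a.comapSubst hL σ hσ) (b.comapSubst hL σ hσ) ↔ canonRel L k o a b := by
  constructor
  · intro h ψ hψ
    have hk := b.isK hψ
    exact (CanonPoint.mem_comapSubst hkk' hid (isK_dia.2 hk)).1
      (h ψ ((CanonPoint.mem_comapSubst hkk' hid hk).2 hψ))
  · exact fun h ψ hψ => ⟨hψ.1, h _ hψ.2⟩

/-- The range of `CanonPoint.comapSubst` is closed under the canonical relations. -/
theorem exists_comapSubst_of_canonRel {hL : IsLogic L} {σ : ℕ → Form O}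
    {hσ : ∀ i < k', IsK k (σ i)} (hkk' : k ≤ k') (hid : ∀ i < k, σ i = var i)
    {o : O} {a : CanonPoint L k} {c : CanonPoint L k'}
    (hac : canonRel L k' o (a.comapSubst hL σ hσ) c) :
    ∃ b : CanonPoint L k, b.comapSubst hL σ hσ = c := by
  -- The identity substitution gives the set of `k`-formulas of `c`. It recovers `c` because `c`
  -- must contain `φ ↔ φ.subst σ` for every `φ ∈ c`.
  refine ⟨c.comapSubst hL var fun i hi => lt_of_lt_of_le hi hkk', ?_⟩
  refine (CanonPoint.ext_of_subset hL fun φ hφ => ?_).symm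
  have hφk := c.isK hφ
  have hsk := hφk.subst hσ
  refine ⟨hφk, hsk, ?_⟩
  rw [(hsk.mono hkk').subst_eq_self fun _ _ => rfl]
  have hik : IsK k' (Form.iff φ (φ.subst σ)) := isK_iff.2 ⟨hφk, hsk.mono hkk'⟩
  by_contra hn
  have h1 : neg (Form.iff φ (φ.subst σ)) ∈ c.1 := by
    rw [c.mem_neg hL hik, c.mem_iff hL hφk (hsk.mono hkk')]
    tauto
  -- Substitution is idempotent, as `φ.subst σ` is a `k`-formula: the failing equivalence would
  -- become `φ.subst σ ↔ φ.subst σ`, refuted at a successor of `a`.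
  have h2 := (hac _ h1).2
  obtain ⟨b, -, hb⟩ := (a.mem_dia hL).1 h2
  change neg (Form.iff (φ.subst σ) ((φ.subst σ).subst σ)) ∈ b.1 at hb
  rw [hsk.subst_eq_self hid] at hb
  have hik' : IsK k (Form.iff (φ.subst σ) (φ.subst σ)) := isK_iff.2 ⟨hsk, hsk⟩
  exact (b.mem_neg hL hik').1 hb ((b.mem_iff hL hsk hsk).2 Iff.rfl)

theorem reach_comapSubst {hL : IsLogic L} {σ : ℕ → Form O}
    {hσ : ∀ i < k', IsK k (σ i)} (hkk' : k ≤ k') (hid : ∀ i < k, σ i = var i)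
    {a : CanonPoint L k} {c : CanonPoint L k'} :
    (canonFrame L k').reach (a.comapSubst hL σ hσ) c ↔
      ∃ b, (canonFrame L k).reach a b ∧ b.comapSubst hL σ hσ = c := by
  constructor
  · intro h
    induction h with
    | refl => exact ⟨a, .refl, rfl⟩
    | tail _ h ih =>
      obtain ⟨b, hab, rfl⟩ := ih
      obtain ⟨o, h⟩ := h
      obtain ⟨d, rfl⟩ := exists_comapSubst_of_canonRel hkk' hid h
      exact ⟨d, hab.tail ⟨o, (canonRel_comapSubst hkk' hid).1 h⟩, rfl⟩
  · rintro ⟨b, hab, rfl⟩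
    exact hab.lift _ fun x y ⟨o, h⟩ => ⟨o, (canonRel_comapSubst hkk' hid).2 h⟩

theorem up_image_comapSubst {hL : IsLogic L} {σ : ℕ → Form O}
    {hσ : ∀ i < k', IsK k (σ i)} (hkk' : k ≤ k') (hid : ∀ i < k, σ i = var i)
    (C : Set (CanonPoint L k)) :
    (canonFrame L k').up (CanonPoint.comapSubst hL σ hσ '' C) =
      CanonPoint.comapSubst hL σ hσ '' (canonFrame L k).up C := by
  ext c
  constructor
  · rintro ⟨_, ⟨a, ha, rfl⟩, hac⟩
    obtain ⟨b, hab, rfl⟩ := (reach_comapSubst hkk' hid).1 hac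
    exact ⟨b, ⟨a, ha, hab⟩, rfl⟩
  · rintro ⟨b, ⟨a, ha, hab⟩, rfl⟩
    exact ⟨_, ⟨a, ha, rfl⟩, (reach_comapSubst hkk' hid).2 ⟨b, hab, rfl⟩⟩

theorem isCluster_image_comapSubst {hL : IsLogic L} {σ : ℕ → Form O}
    {hσ : ∀ i < k', IsK k (σ i)} (hkk' : k ≤ k') (hid : ∀ i < k, σ i = var i)
    {C : Set (CanonPoint L k)} (hC : (canonFrame L k).IsCluster C) :
    (canonFrame L k').IsCluster (CanonPoint.comapSubst hL σ hσ '' C) := by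
  obtain ⟨a, rfl⟩ := hC
  refine ⟨a.comapSubst hL σ hσ, Set.ext fun c => ⟨?_, ?_⟩⟩
  · rintro ⟨b, ⟨hab, hba⟩, rfl⟩
    exact ⟨(reach_comapSubst hkk' hid).2 ⟨b, hab, rfl⟩,
      (reach_comapSubst hkk' hid).2 ⟨a, hba, rfl⟩⟩
  · rintro ⟨hac, hca⟩
    obtain ⟨b, hab, rfl⟩ := (reach_comapSubst hkk' hid).1 hac
    obtain ⟨d, hbd, hda⟩ := (reach_comapSubst hkk' hid).1 hca
    rw [CanonPoint.comapSubst_injective hkk' hid hda] at hbd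
    exact ⟨b, ⟨hab, hbd⟩, rfl⟩

/-- After adding finitely many variables, an infinite cluster with finite complement in the frame it
generates can be chosen so that each successor set of a point outside is named by a variable. -/
theorem exists_cluster_with_names [Fintype O] (hL : IsLogic L) (hpre : Pretransitive L)
    {C : Set (CanonPoint L k)} (hC : (canonFrame L k).IsCluster C) (hinf : C.Infinite)
    (hfin : ((canonFrame L k).up C \ C).Finite) :
    ∃ (k' : ℕ) (C' : Set (CanonPoint L k')), (canonFrame L k').IsCluster C' ∧ C'.Infinite ∧
      ((canonFrame L k').up C' \ C').Finite ∧
      ∀ o, ∀ d ∈ (canonFrame L k').up C' \ C',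
        ∃ i < k', ∀ c ∈ C', canonRel L k' o c d ↔ var i ∈ c.1 := by
  obtain ⟨τ, hτk, hτ⟩ := exists_defining_cluster hL hpre hC hfin
  set D := (canonFrame L k).up C \ C with hD
  choose χ hχ1 hχ2 using fun d : CanonPoint L k => exists_separating hL d hfin
  have hχk : ∀ d, IsK k (χ d) := fun d => d.isK (hχ1 d)
  have hname : ∀ o, ∀ d ∈ D, ∀ c ∈ C,
      canonRel L k o c d ↔ dia o (Form.and (neg τ) (χ d)) ∈ c.1 := by
    intro o d hd c hc
    constructor
    · refine fun h => h _ ((d.mem_and hL (isK_neg.2 hτk) (hχk d)).2 ⟨?_, hχ1 d⟩)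
      rw [d.mem_neg hL hτk, ← hτ d hd.1]
      exact hd.2
    · intro h
      obtain ⟨b, hcb, hb⟩ := (c.mem_dia hL).1 h
      have hbu : b ∈ (canonFrame L k).up C := ⟨c, hc, .single ⟨o, hcb⟩⟩
      rw [b.mem_and hL (isK_neg.2 hτk) (hχk d), b.mem_neg hL hτk, ← hτ b hbu] at hb
      rwa [← hχ2 d b ⟨hbu, hb.1⟩ hb.2]
  have := hfin.to_subtype
  obtain ⟨r, ⟨e⟩⟩ := Finite.exists_equiv_fin (O × D)
  -- Each pair of a modality and a point of `D` gets one new variable, defined by the formula of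
  -- `hname`; `bot` is a filler for indices from `k + r` on.
  let σ : ℕ → Form O := fun i => if i < k then var i else
    if h : i - k < r then
      dia (e.symm ⟨i - k, h⟩).1 (Form.and (neg τ) (χ (e.symm ⟨i - k, h⟩).2)) else bot
  have hσ : ∀ i < k + r, IsK k (σ i) := by
    intro i _
    dsimp only [σ]
    split_ifs with h1 h2
    · exact h1
    · simp [hτk, hχk]
    · trivial
  have hkk' : k ≤ k + r := Nat.le_add_right _ _
  have hid : ∀ i < k, σ i = var i := fun i hi => if_pos hi
  have hinj := CanonPoint.comapSubst_injective (hL := hL) (hσ := hσ) hkk' hid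
  have hup : (canonFrame L (k + r)).up (CanonPoint.comapSubst hL σ hσ '' C) \
      CanonPoint.comapSubst hL σ hσ '' C = CanonPoint.comapSubst hL σ hσ '' D := by
    rw [up_image_comapSubst hkk' hid, hD, Set.image_sdiff hinj]
  refine ⟨k + r, CanonPoint.comapSubst hL σ hσ '' C, isCluster_image_comapSubst hkk' hid hC,
    hinf.image hinj.injOn, hup ▸ hfin.image _, ?_⟩
  rw [hup]
  rintro o _ ⟨d, hd, rfl⟩
  have hlt := (e (o, ⟨d, hd⟩)).2
  refine ⟨k + (e (o, ⟨d, hd⟩) : ℕ), by omega, ?_⟩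
  rintro _ ⟨c, hc, rfl⟩
  have hσe : σ (k + (e (o, ⟨d, hd⟩) : ℕ)) = dia o (Form.and (neg τ) (χ d)) := by
    simp [σ]
  rw [canonRel_comapSubst hkk' hid, hname o d hd c hc, ← hσe]
  exact (and_iff_right (by simp)).symm

end Substitution

end Modal

/-! ### The main theorem -/

theorem mainTheorem5 {O : Type*} [Fintype O] (L : Set (Modal.Form O)) (hL : Modal.IsLogic L)
    (hpre : Modal.Pretransitive L) (hfin : Modal.height L < ⊤)
    (hnlt : ¬ Modal.LocallyTabular L) :
    ∃ (k : ℕ) (C : Set (Modal.CanonPoint L k)),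
      (Modal.canonFrame L k).IsCluster C ∧
      (C.Infinite ∧ ((Modal.canonFrame L k).up C \ C).Finite) ∧
      ((∃ τ : Modal.Form O, τ.IsK k ∧ ∀ a ∈ (Modal.canonFrame L k).up C, a ∈ C ↔ τ ∈ a.1) ∧
        Subtype.val ⁻¹' C ∈ ((Modal.canonFrame L k).gen C).adm) ∧
      (((Modal.canonFrame L k).restrict C).IsGeneralFrame ∧
        ((Modal.canonFrame L k).restrict C).adm.Infinite ∧
        ((Modal.canonFrame L k).restrict C).AlgKGenerated k) ∧
      ¬ Modal.LocallyTabular ((Modal.canonFrame L k).restrict C).Log := by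
  simp only [Modal.LocallyTabular, not_forall] at hnlt
  obtain ⟨k₀, hk₀⟩ := hnlt
  have : Infinite (Modal.CanonPoint L k₀) :=
    not_finite_iff_infinite.1 fun _ => hk₀ (Modal.kFinite_of_finite_canonPoint hL)
  obtain ⟨C₀, hC₀, hinf₀, hfin₀⟩ := Modal.exists_infinite_cluster (k := k₀) hL hpre hfin
  obtain ⟨k, C, hC, hinf, hfinC, hvar⟩ :=
    Modal.exists_cluster_with_names hL hpre hC₀ hinf₀ hfin₀
  obtain ⟨τ, hτk, hτ⟩ := Modal.exists_defining_cluster hL hpre hC hfinC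
  have hadm := Modal.adm_restrict_eq hL hτk hτ hfinC hvar
  have hadmInf := Modal.infinite_adm_restrict hL hinf
  have hG := Modal.isGeneralFrame_restrict hL hτk hτ
  refine ⟨k, C, hC, ⟨hinf, hfinC⟩, ⟨⟨τ, hτk, hτ⟩, ?_⟩, ⟨hG, hadmInf, ?_⟩, ?_⟩
  · exact ⟨_, (Modal.mem_adm_canonFrame hL).2 ⟨τ, hτk, rfl⟩, Set.ext fun a => hτ a.1 a.2⟩
  · refine ⟨(fun i => {c : C | Modal.Form.var i ∈ c.1.1}) '' Set.Iio k, ?_, ?_⟩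
    · refine (Set.encard_image_le _ _).trans ?_
      simp [Set.encard_eq_coe_toFinset_card]
    · rw [hadm]
      exact Set.ext fun U => Modal.Frame.generated_iff_exists_val.symm
  · -- Variables outside the alphabet are evaluated by `∅`.
    refine Modal.Frame.not_locallyTabular_Log
      (θ := fun i => {c : C | Modal.Form.var i ∈ c.1.1}) (k := k) (fun i => ?_) (hadm ▸ hadmInf)
    by_cases hi : i < k
    · exact (Modal.mem_adm_restrict hL).2 ⟨Modal.Form.var i, hi, rfl⟩
    · convert hG.empty_mem
      exact Set.eq_empty_of_forall_notMem fun c hc => hi (c.1.isK hc)
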